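/- **Conventions.** All arrays carry the Euclidean norm and Lebesgue measure; $B_R$ is the closed ball of radius $R$ about $0$. A *Transformer* on $\mathbb R^{d\times n}$ (sequences of $n$ columns of dimension $d$) is a finite composition of blocks, each consisting of $X\mapsto X+\sum_{h}W_O^hW_V^hX\,\mathrm{softmax}\big((W_K^hX)^\top W_Q^hX\big)$ (column-wise softmax) followed by $Y\mapsto Y+W_2\,\mathrm{ReLU}(W_1Y+b_1\mathbf 1^\top)+b_2\mathbf 1^\top$, with arbitrary numbers of blocks and heads, head size and hidden width. A *Transformer with positional encoding* is $X\mapsto t(X+E)$ with $t$ a Transformer and $E$ a fixed array. Graphs are finite and simple. Let $1\le N\le m$. A graph $G$ with node set $\{1,\dots,n\}$, $n\le N$, is represented by tensors $T_G\in\mathbb R^{N\times 2\times m}$: for $j,i\le n$ the entries at $(j,\cdot,i)$ are $\lambda_i$ and $\phi_{i,j}$, where $\lambda_1\le\dots\le\lambda_n$ are the eigenvalues of the Laplacian $D-A$ and $\phi_1,\dots,\phi_n$ is an orthonormal basis of corresponding eigenvectors; all other entries are $0$. There is one representation for each choice of eigenbasis. For a linear injection $M:\mathbb R^{N\times2\times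 m}\to\mathbb R^{N\times k\times m}$, a *node-LPE Transformer* is $g=S\circ t_E\circ M$, where $t_E$ is a Transformer with positional encoding on sequences of length $m$ with tokens in $\mathbb R^{N\times k}$, and $S:\mathbb R^{N\times k\times m}\to\mathbb R^{N\times k}$ is the sum over the last index. **Theorem.** 1. (Node-LPE.) Let $M$ be a linear injection as above and let $R$ be such that $M(T_G)\in B_R$ for all representations of all graphs with at most $N$ nodes. There is a continuous $f:B_R\to\mathbb R^{N\times k\times m}$, zero in all but one coordinate of the $k$-dimension, such that for all representations of graphs on at most $N$ nodes the values $f(M(T_G))$, and also $S(f(M(T_G)))$, depend only on the isomorphism class of $G$ and differ for non-isomorphic graphs. Moreover, for every continuous $f:B_R\to\mathbb R^{N\times k\times m}$ (in particular such a one), every $1\le p<\infty$, $\varepsilon>0$ and every finite set $P$ of representations of graphs on at most $N$ nodes, there is a node-LPE Transformer $g=S\circ t_E\circ M$ with $\|f-t_E\|_{L^p(B_R)}<\varepsilon$, $\|S\circ f\circ M-g\|_{L^p(M^{-1}(B_R))}<\varepsilon$, and $\|S(f(M(T)))-g(T)\|<\varepsilon$ for all $T\in P$. 2. (Naive node Transformer.)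 For any $N$, represent a graph $G$ on $n\le N$ nodes by $X_G=I+A_G$ padded by zeros to size $N\times N$, and let $R$ be such that every $X_G\in B_R$. There is a continuous $f:B_R\to\mathbb R^{N\times N}$ such that $f(X_G)=f(X_H)$ if and only if $G\cong H$, for all graphs on at most $N$ nodes. For every continuous $f:B_R\to\mathbb R^{N\times N}$, $1\le p<\infty$ and $\varepsilon>0$ there is a Transformer with positional encoding $g$ such that $\|f-g\|_{L^p(B_R)}<\varepsilon$ and $\|f(X_G)-g(X_G)\|<\varepsilon$ for all these graphs. 3. (Naive edge Transformer.) For any $N$, represent a graph on $\{1,\dots,N\}$ by the sequence $X_G\in\mathbb R^{2\times N(N-1)/2}$ of the tokens $(c(i,j),\sigma_{ij})$, $i<j$, with $c$ a fixed injective real labelling of the pairs and $\sigma_{ij}\in\{0,1\}$ indicating adjacency; let $R$ be such that every $X_G\in B_R$. There is a continuous $f:B_R\to\mathbb R^{2\times N(N-1)/2}$, equivariant under permutations of the columns, with $f(X_G)=f(X_H)$ if and only if $G\cong H$. For every continuous $f$ on $B_R$ equivariant under permutations of the columns, every $1\le p<\infty$ and $\varepsilon>0$ there is a Transformer $g$ (without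 positional encoding) such that $\|f-g\|_{L^p(B_R)}<\varepsilon$ and $\|f(X_G)-g(X_G)\|<\varepsilon$ for all graphs $G$ on $\{1,\dots,N\}$. 4. (Distinguishing graphs.) For all $1\le N\le m$ and $\varepsilon>0$ there are $k$ and a node-LPE Transformer $g$, whose map $M$ is an injective linear layer $\mathbb R^2\to\mathbb R^k$ applied to the dimension of size $2$, such that for all graphs $G,H$ on at most $N$ nodes and all their representations $T_G,T_H$: $\|g(T_G)-g(T_H)\|<\varepsilon$ if $G\cong H$, and $\|g(T_G)-g(T_H)\|\ge1$ if $G\not\cong H$. 5. (WL tests.) For every $r\ge1$ there is $N_0$ such that for all $N\ge \max(N_0,1)$, $m\ge N$ and $\varepsilon>0$ some $g$ as in 4 moreover satisfies: $\|g(T_G)-g(T_H)\|\ge1$ for all representations of any two graphs on at most $N$ nodes that the $r$-dimensional Weisfeiler–Lehman test distinguishes, and also for all representations of some pair of non-isomorphic graphs on at most $N$ nodes that the $r$-dimensional test does not distinguish. (Here the test colours $r$-tuples, initially by their atomic type; in each round the colour of $v$ is extended by the multiset over all vertices $x$ of the atomic type of $(v,x)$ together with the colours of the tuples obtained by replacing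 one entry of $v$ by $x$; for $r=1$ this is colour refinement. Two graphs are distinguished if after some round their multisets of colours differ.) -/

import Mathlib

open scoped ENNReal

noncomputable section

/-! ### Transformers -/

/-- Real arrays with feature index `α` and sequence (column) index `β`, with the Euclidean norm
and Lebesgue measure. -/
abbrev SeqSpace (α β : Type) : Type := EuclideanSpace ℝ (α × β)

/-- The matrix (features × positions) of an element of `SeqSpace α β`. -/
def SeqSpace.toMat {α β : Type} (X : SeqSpace α β) : Matrix α β ℝ :=
  Matrix.of fun a b => X (a, b)

/-- The element of `SeqSpace α β` with a given matrix. -/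
def SeqSpace.ofMat {α β : Type} (A : Matrix α β ℝ) : SeqSpace α β :=
  WithLp.toLp 2 fun q : α × β => A q.1 q.2

/-- Column-wise softmax. -/
def colSoftmax {β : Type} [Fintype β] (Z : Matrix β β ℝ) : Matrix β β ℝ :=
  Matrix.of fun i j => Real.exp (Z i j) / ∑ l, Real.exp (Z l j)

/-- The weights of one attention head of size `s` on tokens with feature index `α`. -/
structure AttentionHead (α : Type) (s : ℕ) where
  WQ : Matrix (Fin s) α ℝ
  WK : Matrix (Fin s) α ℝ
  WV : Matrix (Fin s) α ℝ
  WO : Matrix α (Fin s) ℝ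

/-- `W_O (W_V X) · softmax ((W_K X)ᵀ (W_Q X))`. -/
def AttentionHead.apply {α β : Type} [Fintype α] [Fintype β] {s : ℕ}
    (h : AttentionHead α s) (X : Matrix α β ℝ) : Matrix α β ℝ :=
  h.WO * ((h.WV * X) * colSoftmax ((h.WK * X).transpose * (h.WQ * X)))

/-- The parameters of one Transformer block: a multi-head self-attention layer followed by a
token-wise feed-forward layer with ReLU activation. -/
structure TransformerBlock (α : Type) where
  numHeads : ℕ
  headSize : ℕ
  hidden : ℕ
  head : Fin numHeads → AttentionHead α headSize
  W₁ : Matrix (Fin hidden) α ℝ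
  b₁ : Fin hidden → ℝ
  W₂ : Matrix α (Fin hidden) ℝ
  b₂ : α → ℝ

/-- Self-attention layer with residual connection. -/
def TransformerBlock.attention {α β : Type} [Fintype α] [Fintype β]
    (B : TransformerBlock α) (X : Matrix α β ℝ) : Matrix α β ℝ :=
  X + ∑ i, (B.head i).apply X

/-- Token-wise feed-forward layer with residual connection:
`X + W₂ ReLU (W₁ X + b₁ 1ᵀ) + b₂ 1ᵀ`. -/
def TransformerBlock.feedForward {α β : Type} [Fintype α]
    (B : TransformerBlock α) (X : Matrix α β ℝ) : Matrix α β ℝ :=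
  X + B.W₂ * (Matrix.of fun i j => max ((B.W₁ * X) i j + B.b₁ i) 0) + Matrix.of fun a _ => B.b₂ a

/-- A Transformer is a finite composition of Transformer blocks. -/
abbrev Transformer (α : Type) : Type := List (TransformerBlock α)

/-- The map on matrices computed by a Transformer; the first block of the list acts first. -/
def Transformer.applyMat {α β : Type} [Fintype α] [Fintype β]
    (t : Transformer α) (X : Matrix α β ℝ) : Matrix α β ℝ :=
  t.foldl (fun Y B => B.feedForward (B.attention Y)) X

/-- The map on `SeqSpace α β` computed by a Transformer. -/
def Transformer.apply {α β : Type} [Fintype α] [Fintype β]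
    (t : Transformer α) (X : SeqSpace α β) : SeqSpace α β :=
  SeqSpace.ofMat (Transformer.applyMat t X.toMat)

/-- A Transformer with (learned, fixed) positional encoding `E`: `X ↦ t (X + E)`. -/
def Transformer.applyPE {α β : Type} [Fintype α] [Fintype β]
    (t : Transformer α) (E X : SeqSpace α β) : SeqSpace α β :=
  Transformer.apply t (X + E)

/-! ### The node-LPE Transformer -/

/-- Input tensors `N × 2 × m`: for each node and each of `m` eigenpairs, the eigenvalue (slot `0`)
and the entry of the eigenvector at the node (slot `1`). -/
abbrev LPEInput (N m : ℕ) : Type := SeqSpace (Fin N × Fin 2) (Fin m)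

/-- Hidden tensors `N × k × m`, seen as sequences of length `m`. -/
abbrev LPEHidden (N k m : ℕ) : Type := SeqSpace (Fin N × Fin k) (Fin m)

/-- Node embeddings `N × k`. -/
abbrev LPEOutput (N k : ℕ) : Type := EuclideanSpace ℝ (Fin N × Fin k)

open Classical in
/-- The tensor representations of a graph on `n` nodes (meant for `n ≤ N ≤ m`): the eigenvalues of
the Laplacian `D - A` in increasing order, with an orthonormal basis of corresponding eigenvectors,
padded with zeros. There is one for each choice of the eigenbasis. -/
def lapReps (N m : ℕ) {n : ℕ} (G : SimpleGraph (Fin n)) : Set (LPEInput N m) :=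
  {T | ∃ (lam : Fin n → ℝ) (φ : OrthonormalBasis (Fin n) ℝ (EuclideanSpace ℝ (Fin n))),
    Monotone lam ∧
    (∀ i, Matrix.mulVec (G.lapMatrix ℝ) (fun v => φ i v) = fun v => lam i * φ i v) ∧
    ∀ (j : Fin N) (i : Fin m),
      T ((j, 0), i) =
        (if h : (j : ℕ) < n ∧ (i : ℕ) < n then lam ⟨i, h.2⟩ else 0) ∧
      T ((j, 1), i) =
        (if h : (j : ℕ) < n ∧ (i : ℕ) < n then φ ⟨i, h.2⟩ ⟨j, h.1⟩ else 0)}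

/-- Sum pooling over the sequence dimension. -/
def sumPool {N k m : ℕ} (X : LPEHidden N k m) : LPEOutput N k :=
  WithLp.toLp 2 fun q : Fin N × Fin k => ∑ i, X (q, i)

/-- The node-LPE Transformer: the linear map `M`, then a Transformer with positional encoding on
the sequence of length `m`, then sum pooling. -/
def lpeTransformer {N k m : ℕ} (M : LPEInput N m →ₗ[ℝ] LPEHidden N k m)
    (t : Transformer (Fin N × Fin k)) (E : LPEHidden N k m) (T : LPEInput N m) : LPEOutput N k :=
  sumPool (t.applyPE E (M T))

/-- The linear layer of the architecture, applied on the dimension of size `2`. -/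
def lpeLinear (N m : ℕ) {k : ℕ} (W : Matrix (Fin k) (Fin 2) ℝ) :
    LPEInput N m →ₗ[ℝ] LPEHidden N k m where
  toFun T := WithLp.toLp 2 fun q : (Fin N × Fin k) × Fin m =>
    ∑ a, W q.1.2 a * T ((q.1.1, a), q.2)
  map_add' T T' := by
    ext q
    simp [mul_add, Finset.sum_add_distrib]
  map_smul' c T := by
    ext q
    simp [mul_add, mul_left_comm]

/-! ### Isomorphism-invariant separating functions -/

/-- With `rep G` the set of representations of a graph `G`: on representations of graphs with at
most `N` nodes, the value of `f` depends only on the isomorphism class, and non-isomorphic graphs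
have different values. -/
def SeparatesIsoClasses {X Y : Type} (N : ℕ)
    (rep : (n : ℕ) → SimpleGraph (Fin n) → Set X) (f : X → Y) : Prop :=
  ∀ (n₁ n₂ : ℕ) (G₁ : SimpleGraph (Fin n₁)) (G₂ : SimpleGraph (Fin n₂)), n₁ ≤ N → n₂ ≤ N →
    ∀ x₁ ∈ rep n₁ G₁, ∀ x₂ ∈ rep n₂ G₂, (f x₁ = f x₂ ↔ Nonempty (G₁ ≃g G₂))

/-- `g` tells the two graphs apart: whichever eigenbases are used, its outputs are at distance at
least `1`. -/
def Distinguishes {N k m : ℕ} (g : LPEInput N m → LPEOutput N k) {n₁ n₂ : ℕ}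
    (G₁ : SimpleGraph (Fin n₁)) (G₂ : SimpleGraph (Fin n₂)) : Prop :=
  ∀ T₁ ∈ lapReps N m G₁, ∀ T₂ ∈ lapReps N m G₂, 1 ≤ dist (g T₁) (g T₂)

/-- `g` identifies the two graphs up to the error `ε`, whichever eigenbases are used. -/
def IdentifiesUpTo {N k m : ℕ} (ε : ℝ) (g : LPEInput N m → LPEOutput N k) {n₁ n₂ : ℕ}
    (G₁ : SimpleGraph (Fin n₁)) (G₂ : SimpleGraph (Fin n₂)) : Prop :=
  ∀ T₁ ∈ lapReps N m G₁, ∀ T₂ ∈ lapReps N m G₂, dist (g T₁) (g T₂) < ε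

/-- On graphs with at most `N` nodes, `g` identifies isomorphic graphs up to the error `ε` and
distinguishes non-isomorphic ones. -/
def ApproxSolvesIso {N k m : ℕ} (ε : ℝ) (g : LPEInput N m → LPEOutput N k) : Prop :=
  ∀ (n₁ n₂ : ℕ) (G₁ : SimpleGraph (Fin n₁)) (G₂ : SimpleGraph (Fin n₂)), n₁ ≤ N → n₂ ≤ N →
    (Nonempty (G₁ ≃g G₂) → IdentifiesUpTo ε g G₁ G₂) ∧
    (¬ Nonempty (G₁ ≃g G₂) → Distinguishes g G₁ G₂)

/-! ### Inputs of the naive graph Transformers -/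

open Classical in
/-- Input of the naive node Transformer: identity plus adjacency matrix of the graph, padded with
zeros to size `N × N`. -/
def nodeInput (N : ℕ) {n : ℕ} (G : SimpleGraph (Fin n)) : SeqSpace (Fin N) (Fin N) :=
  WithLp.toLp 2 fun q : Fin N × Fin N =>
    if h : (q.1 : ℕ) < n ∧ (q.2 : ℕ) < n then
      ((1 : Matrix (Fin n) (Fin n) ℝ) + G.adjMatrix ℝ) ⟨q.1, h.1⟩ ⟨q.2, h.2⟩
    else 0

/-- The `N (N - 1) / 2` pairs `i < j` of node indices. -/
abbrev NodePair (N : ℕ) : Type := {e : Fin N × Fin N // e.1 < e.2}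

open Classical in
/-- Input of the naive edge Transformer: the token of the pair `e = (i, j)` consists of a real
number `code e` labelling the pair and of `1` or `0` as `i, j` are connected or not. -/
def edgeInput {N : ℕ} (code : NodePair N → ℝ) (G : SimpleGraph (Fin N)) :
    SeqSpace (Fin 2) (NodePair N) :=
  WithLp.toLp 2 fun q : Fin 2 × NodePair N =>
    if q.1 = 0 then code q.2 else if G.Adj q.2.1.1 q.2.1.2 then 1 else 0

/-- Permutation of the columns. -/
def permCols {α β : Type} (σ : Equiv.Perm β) (X : SeqSpace α β) : SeqSpace α β :=
  WithLp.toLp 2 fun q : α × β => X (q.1, σ q.2)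

/-! ### The Weisfeiler-Lehman tests -/

/-- Atomic types of `r`-tuples of vertices: the equality and the adjacency pattern. -/
abbrev AtomicType (r : ℕ) : Type := Fin r → Fin r → Prop × Prop

/-- The atomic type of a tuple of vertices. -/
def atomicType {V : Type} (G : SimpleGraph V) {r : ℕ} (v : Fin r → V) : AtomicType r :=
  fun i j => (v i = v j, G.Adj (v i) (v j))

/-- Colours of `r`-tuples after the given number of rounds of the `r`-dimensional test. -/
def WLColor (r : ℕ) : ℕ → Type
  | 0 => AtomicType r
  | s + 1 => WLColor r s × Multiset (AtomicType (r + 1) × (Fin r → WLColor r s))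

/-- The `r`-dimensional Weisfeiler-Lehman colouring. The initial colour of a tuple `v` is its atomic
type. A round adds the multiset, over all vertices `x`, of the atomic type of `(v, x)` and of the
colours of the tuples obtained from `v` by replacing one entry by `x`. For `r = 1` this is colour
refinement. -/
def wlColor {V : Type} [Fintype V] (G : SimpleGraph V) (r : ℕ) :
    (s : ℕ) → (Fin r → V) → WLColor r s
  | 0, v => atomicType G v
  | s + 1, v => (wlColor G r s v, Finset.univ.val.map fun x : V =>
      (atomicType G (Fin.snoc v x : Fin (r + 1) → V),
        fun i : Fin r => wlColor G r s (Function.update v i x)))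

/-- The `r`-dimensional Weisfeiler-Lehman test distinguishes two graphs if after some number of
rounds the multisets of the colours of all `r`-tuples differ. -/
def WLDistinguishes (r : ℕ) {n₁ n₂ : ℕ} (G₁ : SimpleGraph (Fin n₁)) (G₂ : SimpleGraph (Fin n₂)) :
    Prop :=
  ∃ s : ℕ, (Finset.univ.val.map (wlColor G₁ r s) : Multiset (WLColor r s)) ≠
    Finset.univ.val.map (wlColor G₂ r s)

end

/-! Graphs. For every orthonormal eigenbasis, ∑ᵢ (λᵢ + 1) φᵢ φᵢᵀ = L + I. This polynomial in the
input forgets the choice of basis (`lapInput_eq_of_mem_lapReps`), and padded with zeros it still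
determines the graph, since its nonzero diagonal shows the number of nodes. It depends on the
numbering of the nodes, but only finitely many values occur, so a continuous function can send each
of them to a number encoding the isomorphism class. The node inputs I + A are treated in the same
way; for edge inputs one also sums over the column permutations.

Approximation. It suffices to approximate in measure by uniformly bounded Transformers, for an
arbitrary finite measure (`exists_transformer_measure_le`, `exists_mem_approx`). Adding up Lebesgue
measure on the ball, point masses at the prescribed inputs and a pushforward under `M` then yields
all the estimates from one Transformer. A ReLU layer rounds the entries to a grid, off a set of
small measure, and finitely many arrays with distinct columns remain to be interpolated
(`exists_transformer_interp`). One softmax head is enough for that. On scalar tokens forming a set S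
it computes the logarithmic derivative of ∑ exp (s l) over s in S. Exponentials being linearly
independent, this function of l determines S, and by analyticity a single small scale separates all
the finitely many sets (`exists_contextual`). After the head every token encodes itself and the set
of all tokens, and a ReLU function of one variable reads off the value. With positional encoding the
set determines the sequence; without it, equivariance makes the prescribed values consistent.

Statement 4 has a direct construction (`exists_lpeTransformer_code`). A token holds one eigenpair at
all nodes, so its term of the sum above is nearly computed tokenwise; constant attention adds the
terms, and a function locally constant near the finitely many possible values removes the error.

Weisfeiler-Lehman. The test is invariant under isomorphism, so the graphs it distinguishes are
non-isomorphic and statement 4 applies. Strictness comes from Cai-Fürer-Immerman graphs over the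
complete graph on r + 2 vertices: a parity argument excludes an isomorphism, but the defect can
always be moved to a base vertex that the r-tuple does not meet (`CFIRel.step`). -/

/-! ### Feed-forward layers -/

/-- The functions of one real variable computed by ReLU networks with one hidden layer. -/
def reluLine : Submodule ℝ (ℝ → ℝ) :=
  Submodule.span ℝ {s | ∃ a b : ℝ, s = fun x => max (a * x + b) 0}

/-- The scalar functions of a token computed by ReLU networks with one hidden layer. -/
def reluSpan (α : Type) [Fintype α] : Submodule ℝ ((α → ℝ) → ℝ) :=
  Submodule.span ℝ {s | ∃ (w : α → ℝ) (b : ℝ), s = fun x => max (w ⬝ᵥ x + b) 0}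

theorem reluLine.comp_affine {α : Type} [Fintype α] {T : ℝ → ℝ} (hT : T ∈ reluLine)
    (w : α → ℝ) (b : ℝ) : (fun x : α → ℝ => T (w ⬝ᵥ x + b)) ∈ reluSpan α := by
  let c : (ℝ → ℝ) →ₗ[ℝ] ((α → ℝ) → ℝ) := LinearMap.funLeft ℝ ℝ (fun x => w ⬝ᵥ x + b)
  have h : reluLine ≤ (reluSpan α).comap c := by
    refine Submodule.span_le.2 ?_
    rintro _ ⟨a, b', rfl⟩
    refine Submodule.subset_span ⟨a • w, a * b + b', ?_⟩
    funext x
    simp only [c, LinearMap.funLeft_apply, smul_dotProduct, smul_eq_mul]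
    ring_nf
  exact h hT

theorem reluLine.comp_affine_line {T : ℝ → ℝ} (hT : T ∈ reluLine) (c d : ℝ) :
    (fun x => T (c * x + d)) ∈ reluLine := by
  let l : (ℝ → ℝ) →ₗ[ℝ] (ℝ → ℝ) := LinearMap.funLeft ℝ ℝ (fun x => c * x + d)
  have h : reluLine ≤ reluLine.comap l := by
    refine Submodule.span_le.2 ?_
    rintro _ ⟨a, b', rfl⟩
    refine Submodule.subset_span ⟨a * c, a * d + b', ?_⟩
    funext x
    simp only [l, LinearMap.funLeft_apply]
    ring_nf
  exact h hT

theorem reluLine.id_mem : (fun x : ℝ => x) ∈ reluLine := by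
  have h1 : (fun x : ℝ => max (1 * x + 0) 0) ∈ reluLine := Submodule.subset_span ⟨1, 0, rfl⟩
  have h2 : (fun x : ℝ => max ((-1) * x + 0) 0) ∈ reluLine := Submodule.subset_span ⟨-1, 0, rfl⟩
  convert Submodule.sub_mem _ h1 h2 using 1
  funext x
  simp only [Pi.sub_apply]
  rcases le_total x 0 with h | h
  · rw [max_eq_right (by linarith), max_eq_left (by linarith)]; ring
  · rw [max_eq_left (by linarith), max_eq_right (by linarith)]; ring

theorem reluLine.const_mem (c : ℝ) : (fun _ : ℝ => c) ∈ reluLine := by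
  have h1 : (fun x : ℝ => max (0 * x + 1) 0) ∈ reluLine := Submodule.subset_span ⟨0, 1, rfl⟩
  convert Submodule.smul_mem _ c h1 using 1
  funext x
  simp

theorem reluSpan.coord_mem {α : Type} [Fintype α] [DecidableEq α] (a : α) :
    (fun x : α → ℝ => x a) ∈ reluSpan α := by
  simpa using reluLine.comp_affine reluLine.id_mem (Pi.single a 1) 0

theorem reluSpan.const_mem {α : Type} [Fintype α] (c : ℝ) :
    (fun _ : α → ℝ => c) ∈ reluSpan α :=
  reluLine.comp_affine (reluLine.const_mem c) 0 0

theorem reluSpan.sum_mem {α ι : Type} [Fintype α] (s : Finset ι) {T : ι → (α → ℝ) → ℝ}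
    (hT : ∀ i ∈ s, T i ∈ reluSpan α) : (fun x => ∑ i ∈ s, T i x) ∈ reluSpan α := by
  convert Submodule.sum_mem _ hT using 1
  funext x
  simp

/-- A block without attention heads applies to each token any map whose coordinates are ReLU
networks with one hidden layer. -/
theorem exists_block_tokenwise {α β : Type} [Fintype α] [Fintype β]
    (φ : (α → ℝ) → α → ℝ) (hφ : ∀ a, (fun x => φ x a) ∈ reluSpan α) :
    ∃ B : TransformerBlock α, ∀ X : Matrix α β ℝ,
      B.feedForward (B.attention X) = Matrix.of fun a b => φ (fun a' => X a' b) a := by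
  classical
  -- The residual connection adds the token back, so the hidden layer has to compute φ minus the
  -- identity.
  have h : ∀ a, (fun x => φ x a - x a) ∈ reluSpan α := fun a =>
    Submodule.sub_mem _ (hφ a) (reluSpan.coord_mem a)
  have h' : ∀ a, ∃ (n : ℕ) (f : Fin n → ℝ) (w : Fin n → α → ℝ) (b : Fin n → ℝ),
      ∀ x, φ x a - x a = ∑ i, f i * max (w i ⬝ᵥ x + b i) 0 := by
    intro a
    obtain ⟨n, f, g, hg⟩ := Submodule.mem_span_set'.1 (h a)
    choose w b hwb using fun i => (g i).2
    refine ⟨n, f, w, b, fun x => ?_⟩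
    have := congrFun hg x
    simp only [Finset.sum_apply, Pi.smul_apply, smul_eq_mul] at this
    rw [← this]
    exact Finset.sum_congr rfl fun i _ => by rw [hwb i]
  choose n f w b hfw using h'
  let e := Fintype.equivFin (Σ a, Fin (n a))
  refine ⟨⟨0, 0, _, Fin.elim0, Matrix.of fun h => w (e.symm h).1 (e.symm h).2,
    fun h => b (e.symm h).1 (e.symm h).2,
    Matrix.of fun a h => if (e.symm h).1 = a then f (e.symm h).1 (e.symm h).2 else 0, 0⟩, fun X => ?_⟩
  ext a c
  simp only [TransformerBlock.feedForward, TransformerBlock.attention, Finset.univ_eq_empty,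
    Finset.sum_empty, add_zero, Matrix.add_apply, Matrix.mul_apply, Matrix.of_apply, Pi.zero_apply]
  symm
  refine sub_eq_iff_eq_add'.1 ((hfw a fun a' => X a' c).trans (Eq.trans ?_ (Equiv.sum_comp e _)))
  simp only [Equiv.symm_apply_apply]
  rw [Fintype.sum_sigma, Fintype.sum_eq_single a]
  · refine Finset.sum_congr rfl fun x _ => ?_
    have hx : e.symm (e ⟨a, x⟩) = ⟨a, x⟩ := e.symm_apply_apply _
    simp only [dotProduct]
    rw [hx]
    simp
  · intro a' hne
    simp [hne]

/-- A single attention head, without a feed-forward layer. -/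
theorem exists_block_attention {α β : Type} [Fintype α] [Fintype β] {s : ℕ}
    (h : AttentionHead α s) :
    ∃ B : TransformerBlock α, ∀ X : Matrix α β ℝ,
      B.feedForward (B.attention X) = X + h.apply X := by
  refine ⟨⟨1, s, 0, fun _ => h, 0, 0, 0, 0⟩, fun X => ?_⟩
  ext a c
  simp [TransformerBlock.feedForward, TransformerBlock.attention]

/-! ### Piecewise linear functions -/

/-- The ramp from `0` to `1` on `[0, 1]`. -/
noncomputable def ramp (u : ℝ) : ℝ := max u 0 - max (u - 1) 0

theorem ramp_of_nonpos {u : ℝ} (h : u ≤ 0) : ramp u = 0 := by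
  rw [ramp, max_eq_right h, max_eq_right (by linarith)]; ring

theorem ramp_of_one_le {u : ℝ} (h : 1 ≤ u) : ramp u = 1 := by
  rw [ramp, max_eq_left (by linarith), max_eq_left (by linarith)]; ring

theorem ramp_of_mem {u : ℝ} (h0 : 0 ≤ u) (h1 : u ≤ 1) : ramp u = u := by
  rw [ramp, max_eq_left h0, max_eq_right (by linarith)]; ring

theorem ramp_mem_reluLine : ramp ∈ reluLine := by
  have h1 : (fun x : ℝ => max (1 * x + 0) 0) ∈ reluLine := Submodule.subset_span ⟨1, 0, rfl⟩
  have h2 : (fun x : ℝ => max (1 * x + (-1)) 0) ∈ reluLine := Submodule.subset_span ⟨1, -1, rfl⟩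
  convert Submodule.sub_mem _ h1 h2 using 1
  funext x
  simp [ramp, sub_eq_add_neg]

/-- The piecewise linear interpolation of the values of `Y` at the integers `0, …, n`. -/
noncomputable def plInterp (Y : ℕ → ℝ) (n : ℕ) (u : ℝ) : ℝ :=
  Y 0 + ∑ i ∈ Finset.range n, (Y (i + 1) - Y i) * ramp (u - i)

theorem plInterp_mem_reluLine (Y : ℕ → ℝ) (n : ℕ) : plInterp Y n ∈ reluLine := by
  have h : ∀ i ∈ Finset.range n, (fun u : ℝ => (Y (i + 1) - Y i) * ramp (u - i)) ∈ reluLine := by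
    intro i _
    have := Submodule.smul_mem _ (Y (i + 1) - Y i) (reluLine.comp_affine_line ramp_mem_reluLine 1 (-i))
    convert this using 1
    funext u
    simp [sub_eq_add_neg]
  convert Submodule.add_mem _ (reluLine.const_mem (Y 0)) (Submodule.sum_mem _ h) using 1
  funext u
  simp [plInterp]

/-- At most one ramp is strictly between 0 and 1 at `u`; those before it are saturated and those
after it vanish. The sum telescopes to a convex combination of two nodal values, also for `u`
outside [0, n]; only the nearness of the two nodes needs that range. -/
theorem plInterp_eq (Y : ℕ → ℝ) (n : ℕ) (u : ℝ) :
    (n ≤ u → plInterp Y n u = Y n) ∧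
    ∃ (i j : ℕ) (θ : ℝ), 0 ≤ θ ∧ θ ≤ 1 ∧ plInterp Y n u = (1 - θ) * Y i + θ * Y j ∧
      (0 ≤ u → u ≤ n → |i - u| ≤ 1 ∧ |j - u| ≤ 1) := by
  induction n with
  | zero =>
    refine ⟨fun _ => by simp [plInterp], 0, 0, 0, le_rfl, zero_le_one, by simp [plInterp], ?_⟩
    intro h0 h1
    have : u = 0 := le_antisymm (by simpa using h1) h0
    simp [this]
  | succ n ih =>
    have hs : plInterp Y (n + 1) u = plInterp Y n u + (Y (n + 1) - Y n) * ramp (u - n) := by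
      simp only [plInterp, Finset.sum_range_succ]; ring
    obtain ⟨ih1, i, j, θ, h0, h1, h2, h3⟩ := ih
    refine ⟨fun h => ?_, ?_⟩
    · push_cast at h
      rw [hs, ih1 (by linarith), ramp_of_one_le (by linarith)]; ring
    · rcases le_total u n with h | h
      · refine ⟨i, j, θ, h0, h1, ?_, fun hu _ => h3 hu h⟩
        rw [hs, ramp_of_nonpos (by linarith), h2]; ring
      · rcases le_total (u - n) 1 with h' | h'
        · refine ⟨n, n + 1, u - n, by linarith, h', ?_, fun _ _ => ⟨?_, ?_⟩⟩
          · rw [hs, ih1 h, ramp_of_mem (by linarith) h']; ring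
          · rw [abs_le]; constructor <;> linarith
          · push_cast; rw [abs_le]; constructor <;> linarith
        · refine ⟨n + 1, n + 1, 0, le_rfl, zero_le_one, ?_, fun _ hu => ?_⟩
          · rw [hs, ih1 h, ramp_of_one_le h']; ring
          · push_cast at hu ⊢
            rw [abs_le]; refine ⟨⟨?_, ?_⟩, ⟨?_, ?_⟩⟩ <;> linarith

theorem abs_convex_sub_le {a b v ε θ : ℝ} (h0 : 0 ≤ θ) (h1 : θ ≤ 1) (ha : |a - v| ≤ ε)
    (hb : |b - v| ≤ ε) : |(1 - θ) * a + θ * b - v| ≤ ε := by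
  rw [abs_le] at *
  constructor <;> nlinarith

/-- Piecewise linear approximation of an arbitrary function `Y` with mesh at most `g`: its values
lie between values of `Y` at points at distance at most `g`. -/
theorem exists_reluLine_local (Y : ℝ → ℝ) (L : ℝ) {g : ℝ} (hg : 0 < g) :
    ∃ T ∈ reluLine,
      (∀ v ε, (∀ y, |Y y - v| ≤ ε) → ∀ x, |T x - v| ≤ ε) ∧
      ∀ v ε x, |x| ≤ L → (∀ y, |y - x| ≤ g → |Y y - v| ≤ ε) → |T x - v| ≤ ε := by
  -- Enough steps of length `g` for the grid starting at `-L` to pass `L`.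
  obtain ⟨n, hn⟩ := exists_nat_ge (2 * L / g)
  let Z : ℕ → ℝ := fun i => Y (-L + i * g)
  refine ⟨fun x => plInterp Z n (g⁻¹ * x + g⁻¹ * L),
    reluLine.comp_affine_line (plInterp_mem_reluLine Z n) _ _, fun v ε h x => ?_, fun v ε x hx h => ?_⟩
  · obtain ⟨-, i, j, θ, h0, h1, h2, -⟩ := plInterp_eq Z n (g⁻¹ * x + g⁻¹ * L)
    simp only [h2]
    exact abs_convex_sub_le h0 h1 (h _) (h _)
  · obtain ⟨-, i, j, θ, h0, h1, h2, h3⟩ := plInterp_eq Z n (g⁻¹ * x + g⁻¹ * L)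
    simp only [h2]
    rw [abs_le] at hx
    have hu : g⁻¹ * x + g⁻¹ * L = (x + L) / g := by field_simp
    rw [hu] at h3
    have h4 := h3 (div_nonneg (by linarith) hg.le)
      (le_trans (div_le_div_of_nonneg_right (by linarith) hg.le) hn)
    have key : ∀ l : ℕ, |l - (x + L) / g| ≤ 1 → |(-L + l * g) - x| ≤ g := by
      intro l hl
      have : (-L + l * g) - x = (l - (x + L) / g) * g := by field_simp; ring
      rw [this, abs_mul, abs_of_pos hg]
      nlinarith
    exact abs_convex_sub_le h0 h1 (h _ (key i h4.1)) (h _ (key j h4.2))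

/-- Interpolation on a finite set, constant near the nodes and without overshooting. -/
theorem exists_reluLine_plateau (Z : Set ℝ) (hZ : Z.Finite) :
    ∃ η > 0, ∀ (v : ℝ → ℝ) (C : ℝ), 0 ≤ C → (∀ z ∈ Z, |v z| ≤ C) →
      ∃ T ∈ reluLine, (∀ x, |T x| ≤ C) ∧ ∀ z ∈ Z, ∀ x, |x - z| ≤ η → T x = v z := by
  classical
  obtain ⟨δ, hδ, hsep⟩ : ∃ δ > 0, ∀ x ∈ Z, ∀ y ∈ Z, x ≠ y → δ ≤ |x - y| := by
    obtain ⟨c, hc, h⟩ := Set.einfsep_pos.1 hZ.einfsep_pos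
    -- The infimal separation is infinite when `Z` has at most one point, hence the minimum with 1.
    refine ⟨(min c 1).toReal, ENNReal.toReal_pos (lt_min hc one_pos).ne' (by simp),
      fun x hx y hy hxy => ?_⟩
    refine ENNReal.toReal_le_of_le_ofReal (abs_nonneg _) ((min_le_left _ _).trans ?_)
    rw [← Real.dist_eq, ← edist_dist]
    exact h x hx y hy hxy
  obtain ⟨L, hL⟩ : ∃ L, ∀ z ∈ Z, |z| ≤ L := by
    obtain ⟨L, hL⟩ := (hZ.image (fun z => |z|)).bddAbove
    exact ⟨L, fun z hz => hL ⟨z, hz, rfl⟩⟩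
  refine ⟨δ / 6, by positivity, fun v C hC hv => ?_⟩
  -- A step function, constant within δ/3 of each node; these intervals are disjoint. A point within
  -- δ/6 of a node is interpolated with mesh δ/6 from points within δ/3 of the node, so the value
  -- there is exact.
  let Y : ℝ → ℝ := fun y => if h : ∃ z ∈ Z, |y - z| ≤ δ / 3 then v h.choose else 0
  obtain ⟨T, hT, h1, h2⟩ := exists_reluLine_local Y (L + δ / 6) (g := δ / 6) (by positivity)
  refine ⟨T, hT, fun x => ?_, fun z hz x hx => ?_⟩
  · have := h1 0 C (fun y => ?_) x
    · simpa using this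
    · simp only [Y, sub_zero]
      split_ifs with h
      · exact hv _ h.choose_spec.1
      · simpa using hC
  · have h3 : |x| ≤ L + δ / 6 := by
      have := hL z hz
      rw [abs_le] at *
      constructor <;> linarith
    have := h2 (v z) 0 x h3 (fun y hy => ?_)
    · exact sub_eq_zero.1 (abs_nonpos_iff.1 this)
    · have h4 : |y - z| ≤ δ / 3 := by
        rw [abs_le] at *
        constructor <;> linarith
      have h : ∃ z ∈ Z, |y - z| ≤ δ / 3 := ⟨z, hz, h4⟩
      simp only [Y, dif_pos h]
      have h5 : h.choose = z := by
        by_contra hne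
        have h6 := hsep _ h.choose_spec.1 _ hz hne
        have h7 := h.choose_spec.2
        rw [le_abs] at h6
        rw [abs_le] at h4 h7
        rcases h6 with h6 | h6 <;> linarith
      simp [h5]

/-- Approximation of continuous functions on an interval. -/
theorem exists_reluLine_approx (h : ℝ → ℝ) (hh : Continuous h) (L : ℝ) {ε : ℝ} (hε : 0 < ε) :
    ∃ T ∈ reluLine, ∀ x, |x| ≤ L → |T x - h x| ≤ ε := by
  have huc := (isCompact_Icc (a := -(L + 1)) (b := L + 1)).uniformContinuousOn_of_continuous
    hh.continuousOn
  rw [Metric.uniformContinuousOn_iff] at huc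
  obtain ⟨δ, hδ, h1⟩ := huc ε hε
  obtain ⟨T, hT, -, h2⟩ := exists_reluLine_local h L (g := min 1 (δ / 2)) (by positivity)
  refine ⟨T, hT, fun x hx => h2 _ _ x hx fun y hy => ?_⟩
  have hy1 := hy.trans (min_le_left _ _)
  have hy2 := hy.trans (min_le_right _ _)
  refine (h1 y ?_ x ?_ ?_).le
  · rw [abs_le] at hy1 hx
    constructor <;> linarith
  · rw [abs_le] at hx
    constructor <;> linarith
  · rw [Real.dist_eq]; linarith

/-! ### Contextual mapping by a single softmax attention head -/

/-- The average of the elements of `S` with weights proportional to `exp (s * l)`. -/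
noncomputable def softMean (S : Finset ℝ) (l : ℝ) : ℝ :=
  (∑ s ∈ S, s * Real.exp (s * l)) / ∑ s ∈ S, Real.exp (s * l)

theorem sum_exp_pos {S : Finset ℝ} (hS : S.Nonempty) (l : ℝ) :
    0 < ∑ s ∈ S, Real.exp (s * l) :=
  Finset.sum_pos (fun _ _ => Real.exp_pos _) hS

theorem hasDerivAt_sum_exp (S : Finset ℝ) (l : ℝ) :
    HasDerivAt (fun l => ∑ s ∈ S, Real.exp (s * l)) (∑ s ∈ S, s * Real.exp (s * l)) l := by
  refine HasDerivAt.fun_sum fun s _ => ?_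
  have := (((hasDerivAt_id l).const_mul s).exp)
  simpa [mul_comm] using this

theorem analyticOnNhd_softMean {S : Finset ℝ} (hS : S.Nonempty) :
    AnalyticOnNhd ℝ (softMean S) Set.univ := by
  intro l _
  have h : ∀ s : ℝ, AnalyticAt ℝ (fun l => Real.exp (s * l)) l := fun s =>
    (analyticAt_const.mul analyticAt_id).rexp
  refine AnalyticAt.div ?_ ?_ (sum_exp_pos hS l).ne'
  · exact Finset.analyticAt_fun_sum _ fun s _ => analyticAt_const.mul (h s)
  · exact Finset.analyticAt_fun_sum _ fun s _ => h s

/-- Exponential functions with distinct exponents are linearly independent. -/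
theorem linearIndependent_exp_mul :
    LinearIndependent ℝ (fun s : ℝ => fun l : ℝ => Real.exp (s * l)) := by
  let φ : ℝ → (Multiplicative ℝ →* ℝ) := fun s =>
    { toFun := fun l => Real.exp (s * l.toAdd)
      map_one' := by simp
      map_mul' := fun x y => by rw [toAdd_mul, mul_add, Real.exp_add] }
  have hφ : Function.Injective φ := by
    intro s s' h
    have := DFunLike.congr_fun h (Multiplicative.ofAdd (1 : ℝ))
    simpa [φ] using this
  exact (linearIndependent_monoidHom (Multiplicative ℝ) ℝ).comp φ hφ

/-- `softMean S` is the logarithmic derivative of ∑ exp (s l). If two of them agree, the quotient of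
the two exponential sums is constant, and linear independence of the exponentials compares the
exponents. -/
theorem softMean_injective {S S' : Finset ℝ} (hS : S.Nonempty) (hS' : S'.Nonempty)
    (h : softMean S = softMean S') : S = S' := by
  classical
  set Z : Finset ℝ → ℝ → ℝ := fun S l => ∑ s ∈ S, Real.exp (s * l) with hZ
  have hd : ∀ l, HasDerivAt (fun l => Z S l / Z S' l) 0 l := by
    intro l
    have h1 := (hasDerivAt_sum_exp S l).div (hasDerivAt_sum_exp S' l) (sum_exp_pos hS' l).ne'
    refine h1.congr_deriv ?_
    have h2 := congrFun h l
    rw [softMean, softMean, div_eq_div_iff (sum_exp_pos hS l).ne' (sum_exp_pos hS' l).ne'] at h2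
    rw [h2]
    ring
  have hc : ∀ l, Z S l = (Z S 0 / Z S' 0) * Z S' l := by
    intro l
    have := is_const_of_deriv_eq_zero (fun l => (hd l).differentiableAt)
      (fun l => (hd l).deriv) l 0
    rw [← this, div_mul_cancel₀ _ (sum_exp_pos hS' l).ne']
  set c := Z S 0 / Z S' 0 with hcdef
  have hc0 : c ≠ 0 := (div_pos (sum_exp_pos hS 0) (sum_exp_pos hS' 0)).ne'
  have hli := linearIndependent_iff'.1 linearIndependent_exp_mul (S ∪ S')
    (fun s => (if s ∈ S then 1 else 0) - c * (if s ∈ S' then 1 else 0)) (by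
      funext l
      have h1 : ∑ s ∈ S ∪ S', (if s ∈ S then (1 : ℝ) else 0) * Real.exp (s * l) = Z S l := by
        simp only [hZ, ite_mul, one_mul, zero_mul]
        rw [← Finset.sum_filter]
        congr 1
        ext s; simp
      have h2 : ∑ s ∈ S ∪ S', (if s ∈ S' then (1 : ℝ) else 0) * Real.exp (s * l) = Z S' l := by
        simp only [hZ, ite_mul, one_mul, zero_mul]
        rw [← Finset.sum_filter]
        congr 1
        ext s; simp
      simp only [Finset.sum_apply, Pi.smul_apply, smul_eq_mul, sub_mul, Finset.sum_sub_distrib,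
        mul_assoc, ← Finset.mul_sum, Pi.zero_apply]
      rw [h1, h2, hc l, sub_self])
  ext s
  constructor
  · intro hs
    by_contra hs'
    simpa [hs, hs'] using hli s (Finset.mem_union_left _ hs)
  · intro hs
    by_contra hs'
    exact hc0 (by simpa [hs, hs'] using hli s (Finset.mem_union_right _ hs))

-- Otherwise the two analytic functions would agree at points accumulating at 0, hence everywhere.
-- The point 0 itself must be left out: there only the arithmetic means are compared.
open Filter Topology in
theorem eventually_softMean_ne {S S' : Finset ℝ} (hS : S.Nonempty) (hS' : S'.Nonempty)
    (h : S ≠ S') : ∀ᶠ l in 𝓝[≠] (0 : ℝ), softMean S l ≠ softMean S' l := by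
  by_contra hc
  refine h (softMean_injective hS hS' ?_)
  refine (analyticOnNhd_softMean hS).eq_of_frequently_eq (analyticOnNhd_softMean hS') (z₀ := 0) ?_
  exact hc

open Filter Topology in
/-- For suitable `a` and `w`, the value `t + w * softMean S (a * t)` determines the set `S` and its
element `t`, for subsets of a given finite set of positive numbers. -/
theorem exists_contextual (T : Finset ℝ) (hT : ∀ t ∈ T, 0 < t) :
    ∃ a w : ℝ, ∀ S ⊆ T, ∀ S' ⊆ T, ∀ t ∈ S, ∀ t' ∈ S',
      t + w * softMean S (a * t) = t' + w * softMean S' (a * t') → S = S' ∧ t = t' := by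
  classical
  -- The scale `a` is chosen to separate the sets at every logit `a * t`. These are nonzero because
  -- the tokens are positive.
  have h1 : ∀ᶠ a in 𝓝[≠] (0 : ℝ), ∀ p ∈ T.powerset ×ˢ T.powerset ×ˢ T,
      p.1.Nonempty → p.2.1.Nonempty → p.1 ≠ p.2.1 →
        softMean p.1 (a * p.2.2) ≠ softMean p.2.1 (a * p.2.2) := by
    rw [Filter.eventually_all_finset]
    rintro ⟨S, S', t⟩ hp
    simp only [Finset.mem_product, Finset.mem_powerset] at hp ⊢
    by_cases hS : S.Nonempty
    swap; · simp [hS]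
    by_cases hS' : S'.Nonempty
    swap; · simp [hS']
    by_cases hne : S = S'
    · simp [hne]
    have ht := hT t hp.2.2
    have hlim : Tendsto (fun a : ℝ => a * t) (𝓝[≠] 0) (𝓝[≠] 0) := by
      refine tendsto_nhdsWithin_iff.2 ⟨?_, ?_⟩
      · have : Tendsto (fun a : ℝ => a * t) (𝓝 0) (𝓝 (0 * t)) :=
          (continuous_mul_const t).tendsto 0
        rw [zero_mul] at this
        exact this.mono_left nhdsWithin_le_nhds
      · filter_upwards [self_mem_nhdsWithin] with a ha
        exact mul_ne_zero ha ht.ne'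
    filter_upwards [hlim.eventually (eventually_softMean_ne hS hS' hne)] with a ha _ _ _
    exact ha
  obtain ⟨a, ha⟩ := h1.exists
  -- For small `w` the term with `softMean` cannot make different `t` collide; for equal `t`, a
  -- nonzero `w` lets it separate the sets.
  have h2 : ∀ᶠ w in 𝓝[≠] (0 : ℝ), ∀ p ∈ (T.powerset ×ˢ T) ×ˢ (T.powerset ×ˢ T),
      p.1.2 ≠ p.2.2 → p.1.2 + w * softMean p.1.1 (a * p.1.2) ≠
        p.2.2 + w * softMean p.2.1 (a * p.2.2) := by
    rw [Filter.eventually_all_finset]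
    rintro ⟨⟨S, t⟩, ⟨S', t'⟩⟩ _
    by_cases hne : t = t'
    · simp [hne]
    refine Filter.Eventually.filter_mono nhdsWithin_le_nhds ?_
    have hcont : Continuous fun w : ℝ =>
        (t + w * softMean S (a * t)) - (t' + w * softMean S' (a * t')) := by fun_prop
    have := hcont.continuousAt.eventually_ne (x := 0) (y := 0) (by simpa [sub_eq_zero] using hne)
    filter_upwards [this] with w hw _
    exact sub_ne_zero.1 hw
  obtain ⟨w, hw, hw0⟩ := (h2.and self_mem_nhdsWithin).exists
  refine ⟨a, w, fun S hS S' hS' t ht t' ht' h => ?_⟩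
  have htt : t = t' := by
    by_contra hne
    exact hw ((S, t), (S', t')) (by simp [hS, hS', hS ht, hS' ht']) hne h
  subst htt
  refine ⟨?_, rfl⟩
  by_contra hne
  refine ha (S, S', t) (by simp [hS, hS', hS ht]) ⟨t, ht⟩ ⟨t, ht'⟩ hne ?_
  exact mul_left_cancel₀ hw0 (add_left_cancel h)

/-- A functional can be chosen off the finitely many hyperplanes annihilating the differences of
distinct points. -/
theorem exists_dotProduct_injOn {α : Type} [Fintype α] {Z : Set (α → ℝ)} (hZ : Z.Finite) :
    ∃ w : α → ℝ, Set.InjOn (fun x => w ⬝ᵥ x) Z := by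
  classical
  have : Finite Z := hZ
  let ι := {p : Z × Z // p.1 ≠ p.2}
  obtain ⟨f, hf⟩ := Module.exists_dual_forall_apply_ne_zero (K := ℝ)
    (fun p : ι => (p.1.1 : α → ℝ) - p.1.2)
    (fun p => sub_ne_zero.2 fun h => p.2 (Subtype.ext h))
  have hfw : ∀ x, f x = (fun a => f (Pi.single a 1)) ⬝ᵥ x := by
    intro x
    rw [LinearMap.pi_apply_eq_sum_univ f x, dotProduct]
    refine Finset.sum_congr rfl fun a _ => ?_
    rw [smul_eq_mul, mul_comm]
    congr 2
    funext j
    simp [Pi.single_apply, eq_comm]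
  refine ⟨fun a => f (Pi.single a 1), fun x hx y hy h => ?_⟩
  by_contra hne
  refine hf ⟨(⟨x, hx⟩, ⟨y, hy⟩), fun h' => hne (congrArg Subtype.val h')⟩ ?_
  rw [map_sub, hfw x, hfw y]
  exact sub_eq_zero.2 h

/-! ### Interpolation by Transformers -/

theorem Transformer.applyMat_cons {α β : Type} [Fintype α] [Fintype β] (B : TransformerBlock α)
    (t : Transformer α) (X : Matrix α β ℝ) :
    Transformer.applyMat (B :: t) X = Transformer.applyMat t (B.feedForward (B.attention X)) :=
  rfl

theorem Transformer.applyMat_nil {α β : Type} [Fintype α] [Fintype β] (X : Matrix α β ℝ) :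
    Transformer.applyMat [] X = X :=
  rfl

/-- Queries and values are the scalar tokens and keys are `a` times them, so the logits are `a * τ l
* τ b`. Distinctness of the tokens turns the sum over positions into a sum over the set of tokens.
-/
theorem scalar_head_apply {α β : Type} [Fintype α] [DecidableEq α] [Fintype β] (a₀ : α)
    (a w : ℝ) (τ : β → ℝ) (hτ : Function.Injective τ) :
    AttentionHead.apply (s := 1)
      ⟨Matrix.of fun _ => Pi.single a₀ 1, Matrix.of fun _ => Pi.single a₀ a,
        Matrix.of fun _ => Pi.single a₀ 1, Matrix.of fun i _ => if i = a₀ then w else 0⟩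
      (Matrix.of fun i b => if i = a₀ then τ b else 0 : Matrix α β ℝ) =
    Matrix.of fun i b =>
      if i = a₀ then w * softMean (Finset.univ.image τ) (a * τ b) else 0 := by
  ext i b
  simp only [AttentionHead.apply, colSoftmax, Matrix.mul_apply, Matrix.transpose_apply,
    Matrix.of_apply, Pi.single_apply, Finset.univ_unique, Finset.sum_singleton,
    ite_mul, mul_ite, one_mul, zero_mul, mul_zero, Finset.sum_ite_eq', Finset.mem_univ, if_true]
  refine if_congr Iff.rfl ?_ rfl
  rw [softMean, Finset.sum_image fun _ _ _ _ h => hτ h, Finset.sum_image fun _ _ _ _ h => hτ h,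
    Finset.sum_div]
  congr 1
  refine Finset.sum_congr rfl fun l _ => ?_
  rw [mul_div_assoc]
  have : ∀ l, a * τ l * τ b = τ l * (a * τ b) := fun l => by ring
  simp only [this]

/-- Transformers interpolate compatible values at finitely many inputs with distinct columns,
without overshooting. -/
theorem exists_transformer_interp {α β : Type} [Fintype α] [Fintype β] [Nonempty α]
    {𝒰 : Set (Matrix α β ℝ)} (hfin : 𝒰.Finite)
    (hinj : ∀ U ∈ 𝒰, Function.Injective U.transpose)
    (y : Matrix α β ℝ → Matrix α β ℝ) {C : ℝ} (hC : 0 ≤ C)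
    (hy : ∀ U ∈ 𝒰, ∀ i b, |y U i b| ≤ C)
    (hcompat : ∀ U ∈ 𝒰, ∀ U' ∈ 𝒰, ∀ b b', Set.range U.transpose = Set.range U'.transpose →
      U.transpose b = U'.transpose b' → ∀ i, y U i b = y U' i b') :
    ∃ t : Transformer α, (∀ U ∈ 𝒰, t.applyMat U = y U) ∧
      ∀ (X : Matrix α β ℝ) i b, |t.applyMat X i b| ≤ C := by
  classical
  obtain ⟨a₀⟩ := ‹Nonempty α›
  set Tok : Set (α → ℝ) := ⋃ U ∈ 𝒰, Set.range U.transpose with hTok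
  have hTokfin : Tok.Finite := hfin.biUnion fun U _ => Set.finite_range _
  have hmem : ∀ U ∈ 𝒰, ∀ b, U.transpose b ∈ Tok := fun U hU b =>
    Set.mem_biUnion hU ⟨b, rfl⟩
  obtain ⟨v, hv⟩ := exists_dotProduct_injOn hTokfin
  obtain ⟨κ, hκ⟩ : ∃ κ : ℝ, ∀ u ∈ Tok, 0 < v ⬝ᵥ u + κ := by
    obtain ⟨m, hm⟩ := (hTokfin.image fun u => v ⬝ᵥ u).bddBelow
    exact ⟨1 - m, fun u hu => by linarith [hm ⟨u, hu, rfl⟩]⟩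
  set τ : (α → ℝ) → ℝ := fun u => v ⬝ᵥ u + κ with hτ
  have hτinj : Set.InjOn τ Tok := fun x hx y hy h => hv hx hy (add_right_cancel h)
  obtain ⟨a, w, haw⟩ := exists_contextual (hTokfin.toFinset.image τ) (by
    intro t ht
    simp only [Finset.mem_image, Set.Finite.mem_toFinset] at ht
    obtain ⟨u, hu, rfl⟩ := ht
    exact hκ u hu)
  let S : Matrix α β ℝ → Finset ℝ := fun U => Finset.univ.image fun b => τ (U.transpose b)
  let code : Matrix α β ℝ → β → ℝ := fun U b =>
    τ (U.transpose b) + w * softMean (S U) (a * τ (U.transpose b))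
  have hcode : ∀ U ∈ 𝒰, ∀ U' ∈ 𝒰, ∀ b b', code U b = code U' b' →
      ∀ i, y U i b = y U' i b' := by
    intro U hU U' hU' b b' h
    have hsub : ∀ U ∈ 𝒰, S U ⊆ hTokfin.toFinset.image τ := by
      intro U hU t ht
      simp only [S, Finset.mem_image, Finset.mem_univ, true_and] at ht
      obtain ⟨b, rfl⟩ := ht
      exact Finset.mem_image_of_mem _ (hTokfin.mem_toFinset.2 (hmem U hU b))
    obtain ⟨h1, h2⟩ := haw _ (hsub U hU) _ (hsub U' hU') _
      (Finset.mem_image_of_mem _ (Finset.mem_univ b)) _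
      (Finset.mem_image_of_mem _ (Finset.mem_univ b')) h
    refine hcompat U hU U' hU' b b' ?_ (hτinj (hmem U hU b) (hmem U' hU' b') h2)
    have h3 : τ '' Set.range U.transpose = τ '' Set.range U'.transpose := by
      have := congrArg (fun s : Finset ℝ => (s : Set ℝ)) h1
      have hr : ∀ V : Matrix α β ℝ, τ '' Set.range V.transpose = ((S V : Finset ℝ) : Set ℝ) := by
        intro V
        simp only [S, Finset.coe_image, Finset.coe_univ, Set.image_univ]
        exact (Set.range_comp τ (fun b => V.transpose b)).symm
      exact (hr U).trans (this.trans (hr U').symm)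
    exact (hτinj.image_eq_image_iff (Set.range_subset_iff.2 (hmem U hU))
      (Set.range_subset_iff.2 (hmem U' hU'))).1 h3
  set Z : Set ℝ := ⋃ U ∈ 𝒰, Set.range (code U) with hZ
  have hZfin : Z.Finite := hfin.biUnion fun U _ => Set.finite_range _
  obtain ⟨η, hη, hT⟩ := exists_reluLine_plateau Z hZfin
  -- The value to be read off at a code. By `hcode` it does not depend on the chosen array and
  -- position; elsewhere the default 0 is immaterial.
  let val : α → ℝ → ℝ := fun i z =>
    if h : ∃ p : Matrix α β ℝ × β, p.1 ∈ 𝒰 ∧ code p.1 p.2 = z then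
      y h.choose.1 i h.choose.2 else 0
  have hval : ∀ U ∈ 𝒰, ∀ b i, val i (code U b) = y U i b := by
    intro U hU b i
    have h : ∃ p : Matrix α β ℝ × β, p.1 ∈ 𝒰 ∧ code p.1 p.2 = code U b := ⟨(U, b), hU, rfl⟩
    simp only [val, dif_pos h]
    exact hcode _ h.choose_spec.1 _ hU _ _ h.choose_spec.2 i
  have hT' := fun i => hT (val i) C hC (by
    intro z hz
    obtain ⟨U, hU, b, rfl⟩ : ∃ U ∈ 𝒰, ∃ b, code U b = z := by simpa [hZ] using hz
    rw [hval U hU]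
    exact hy U hU i b)
  choose T hTm hTC hTv using hT'
  -- Three blocks: compress each token to a scalar in row `a₀`, add the head's average to it, read
  -- off the output. The last layer is bounded by `C` on all of the line, which gives the bound for
  -- arbitrary inputs.
  obtain ⟨B₁, hB₁⟩ := exists_block_tokenwise (β := β)
    (fun (x : α → ℝ) i => if i = a₀ then τ x else 0) (by
      intro i
      by_cases hi : i = a₀
      · simpa [hi, hτ] using reluLine.comp_affine reluLine.id_mem v κ
      · simpa [hi] using reluSpan.const_mem (α := α) 0)
  obtain ⟨B₂, hB₂⟩ := exists_block_attention (β := β) (s := 1)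
    (⟨Matrix.of fun _ => Pi.single a₀ 1, Matrix.of fun _ => Pi.single a₀ a,
        Matrix.of fun _ => Pi.single a₀ 1, Matrix.of fun i _ => if i = a₀ then w else 0⟩ :
      AttentionHead α 1)
  obtain ⟨B₃, hB₃⟩ := exists_block_tokenwise (β := β) (fun (x : α → ℝ) i => T i (x a₀)) (by
      intro i
      simpa using reluLine.comp_affine (hTm i) (Pi.single a₀ 1) 0)
  refine ⟨[B₁, B₂, B₃], fun U hU => ?_, fun X i b => ?_⟩
  · have hτU : Function.Injective fun b => τ (U.transpose b) := fun b b' h =>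
      hinj U hU (hτinj (hmem U hU b) (hmem U hU b') h)
    simp only [Transformer.applyMat_cons, Transformer.applyMat_nil, hB₁, hB₂, hB₃]
    have := scalar_head_apply a₀ a w _ hτU
    change AttentionHead.apply _ (Matrix.of fun i b => if i = a₀ then τ (fun a' => U a' b) else 0)
      = _ at this
    rw [this]
    ext i b
    simp only [Matrix.of_apply, Matrix.add_apply, if_true]
    rw [← hval U hU]
    refine hTv i _ (Set.mem_biUnion hU ⟨b, rfl⟩) _ ?_
    change |code U b - code U b| ≤ η
    simpa using hη.le
  · simp only [Transformer.applyMat_cons, Transformer.applyMat_nil, hB₃, Matrix.of_apply]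
    exact hTC i _

/-! ### Approximation in measure -/

-- The exceptional sets for δ = 1/(n + 1) decrease to a null set, and the measure is continuous from
-- above.
open MeasureTheory Filter Topology in
theorem exists_measure_le_of_ae_pos {Ω ι : Type*} [MeasurableSpace Ω] [Finite ι] (μ : Measure Ω)
    [IsFiniteMeasure μ] (d : ι → Ω → ℝ) (hd : ∀ i, Measurable (d i))
    (hpos : ∀ i, ∀ᵐ x ∂μ, 0 < d i x) {η : ℝ≥0∞} (hη : η ≠ 0) :
    ∃ δ > 0, μ {x | ∃ i, d i x ≤ δ} ≤ η := by
  let s : ℕ → Set Ω := fun n => {x | ∃ i, d i x ≤ 1 / ((n : ℝ) + 1)}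
  have hs : ∀ n, MeasurableSet (s n) := fun n => by
    have : s n = ⋃ i, {x | d i x ≤ 1 / ((n : ℝ) + 1)} := by ext x; simp [s]
    rw [this]
    exact MeasurableSet.iUnion fun i => measurableSet_le (hd i) measurable_const
  have hanti : Antitone s := by
    intro n m hnm x hx
    obtain ⟨i, hi⟩ := hx
    exact ⟨i, hi.trans (one_div_le_one_div_of_le (by positivity) (by simpa using hnm))⟩
  have hlim := tendsto_measure_iInter_atTop (μ := μ) (fun n => (hs n).nullMeasurableSet) hanti
    ⟨0, measure_ne_top _ _⟩
  have hzero : μ (⋂ n, s n) = 0 := by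
    have hall : ∀ᵐ x ∂μ, ∀ i, 0 < d i x := ae_all_iff.2 hpos
    refine measure_mono_null (fun x hx => ?_) hall
    intro hx'
    have h1 : ∀ᶠ n : ℕ in atTop, ∀ i, 1 / ((n : ℝ) + 1) < d i x :=
      eventually_all.2 fun i => tendsto_one_div_add_atTop_nhds_zero_nat.eventually_lt_const (hx' i)
    obtain ⟨n, hn⟩ := h1.exists
    obtain ⟨i, hi⟩ := Set.mem_iInter.1 hx n
    exact absurd (hn i) (not_lt.2 hi)
  rw [hzero] at hlim
  obtain ⟨n, hn⟩ := (hlim.eventually_le_const (pos_iff_ne_zero.2 hη)).exists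
  exact ⟨1 / ((n : ℝ) + 1), by positivity, hn⟩

open MeasureTheory in
/-- A translate of a lattice that avoids the atoms of finitely many real random variables. -/
theorem exists_offset {Ω ι : Type*} [MeasurableSpace Ω] [Countable ι] (μ : Measure Ω)
    [IsFiniteMeasure μ] (f : ι → Ω → ℝ) (hf : ∀ i, Measurable (f i)) (g : ℝ) :
    ∃ c : ℝ, ∀ i, ∀ᵐ x ∂μ, ∀ k : ℤ, f i x ≠ c + g * k := by
  let A : ι → Set ℝ := fun i => {t | 0 < μ {x | f i x = t}}
  -- A finite measure charges only countably many level sets, so only countably many offsets are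
  -- forbidden.
  have hA : ∀ i, (A i).Countable := fun i => Measure.countable_meas_level_set_pos (hf i)
  have hB : (⋃ i, ⋃ k : ℤ, (fun t => t - g * k) '' A i).Countable :=
    Set.countable_iUnion fun i => Set.countable_iUnion fun k => (hA i).image _
  obtain ⟨c, hc⟩ := (hB.dense_compl ℝ).nonempty
  refine ⟨c, fun i => ae_all_iff.2 fun k => ?_⟩
  have hck : c + g * k ∉ A i := fun h =>
    hc (Set.mem_iUnion.2 ⟨i, Set.mem_iUnion.2 ⟨k, _, h, by simp⟩⟩)
  have h0 : μ {x | f i x = c + g * k} = 0 := by simpa [A] using hck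
  rw [ae_iff]
  simpa using h0

theorem euclidean_norm_le {ι : Type} [Fintype ι] {x : EuclideanSpace ℝ ι} {c : ℝ} (hc : 0 ≤ c)
    (h : ∀ i, |x i| ≤ c) : ‖x‖ ≤ Fintype.card ι * c := by
  rw [EuclideanSpace.norm_eq]
  refine Real.sqrt_le_iff.2 ⟨by positivity, ?_⟩
  calc ∑ i, ‖x i‖ ^ 2 ≤ ∑ _i : ι, c ^ 2 :=
        Finset.sum_le_sum fun i _ => pow_le_pow_left₀ (norm_nonneg _) (h i) 2
    _ = Fintype.card ι * c ^ 2 := by simp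
    _ ≤ (Fintype.card ι * c) ^ 2 := by
        rw [mul_pow]
        refine mul_le_mul_of_nonneg_right ?_ (sq_nonneg c)
        exact_mod_cast Nat.le_self_pow two_ne_zero _

theorem floor_eq_of_abs_sub_le {u v δ : ℝ} (h : δ < min (Int.fract u) (1 - Int.fract u))
    (hv : |v - u| ≤ δ) : ⌊v⌋ = ⌊u⌋ := by
  rw [lt_min_iff] at h
  rw [abs_le] at hv
  have := Int.floor_add_fract u
  rw [Int.floor_eq_iff]
  constructor <;> linarith

theorem abs_grid_sub_le {c g : ℝ} (hg : 0 < g) (x : ℝ) :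
    |c + g * ⌊(x - c) / g⌋ - x| ≤ g := by
  have h1 := Int.floor_le ((x - c) / g)
  have h2 := Int.lt_floor_add_one ((x - c) / g)
  rw [le_div_iff₀ hg] at h1
  rw [div_lt_iff₀ hg] at h2
  rw [abs_le]
  constructor <;> nlinarith

/-- The values `F U` at arrays near `K` with distinct columns depend, column by column, only on the
set of columns and on the column itself. -/
def ColumnCompatible {α β : Type} (K : Set (SeqSpace α β)) (F : SeqSpace α β → SeqSpace α β) :
    Prop :=
  ∀ X ∈ K, ∀ X' ∈ K, ∀ U U' : SeqSpace α β, (∀ q, |U q - X q| ≤ 1) → (∀ q, |U' q - X' q| ≤ 1) →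
    Function.Injective U.toMat.transpose → Function.Injective U'.toMat.transpose →
    Set.range U.toMat.transpose = Set.range U'.toMat.transpose →
    ∀ b b', U.toMat.transpose b = U'.toMat.transpose b' → ∀ i, F U (i, b) = F U' (i, b')

-- Round the entries to a grid and interpolate `F` at the finitely many rounded arrays. This can
-- fail only where two columns are nearly equal or an entry is close to a jump of the rounding;
-- suitable thresholds give each of the two sets measure at most η/2. As `μ` may have atoms, the
-- grid is shifted off them.
open MeasureTheory in
theorem exists_transformer_measure_le {α β : Type} [Fintype α] [Fintype β] [Nonempty α]
    (μ : Measure (SeqSpace α β)) [IsFiniteMeasure μ] {ρ : ℝ} (hρ : ∀ᵐ X ∂μ, ‖X‖ ≤ ρ)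
    (hcol : ∀ᵐ X ∂μ, Function.Injective X.toMat.transpose)
    {F : SeqSpace α β → SeqSpace α β} (hF : Continuous F) {C : ℝ} (hC : 0 ≤ C)
    (hFC : ∀ X q, |F X q| ≤ C) {K : Set (SeqSpace α β)} (hK : ∀ᵐ X ∂μ, X ∈ K)
    (hcompat : ColumnCompatible K F) {ε : ℝ} (hε : 0 < ε) {η : ℝ≥0∞} (hη : η ≠ 0) :
    ∃ t : Transformer α, (∀ (X : SeqSpace α β) q, |t.apply X q| ≤ C) ∧ μ {X | ε ≤ ‖F X - t.apply X‖} ≤ η := by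
  classical
  obtain ⟨D, hD⟩ : ∃ D : ℝ, D = (Fintype.card (α × β) : ℝ) := ⟨_, rfl⟩
  have hD0 : 0 ≤ D := hD ▸ Nat.cast_nonneg _
  have hη2 : η / 2 ≠ 0 := by simpa using hη
  have huc := (isCompact_closedBall (0 : SeqSpace α β) (ρ + 1)).uniformContinuousOn_of_continuous
    hF.continuousOn
  rw [Metric.uniformContinuousOn_iff] at huc
  obtain ⟨δ, hδ, hFδ⟩ := huc ε hε
  obtain ⟨δ₂, hδ₂, hbad₂⟩ := exists_measure_le_of_ae_pos (ι := {p : β × β // p.1 ≠ p.2}) μ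
    (fun p X => ∑ i, |X (i, p.1.1) - X (i, p.1.2)|) (fun p => by fun_prop) (by
      rintro ⟨⟨b, b'⟩, hne⟩
      filter_upwards [hcol] with X hX
      refine lt_of_le_of_ne (Finset.sum_nonneg fun _ _ => abs_nonneg _) fun h => hne (hX ?_)
      rw [eq_comm, Finset.sum_eq_zero_iff_of_nonneg fun _ _ => abs_nonneg _] at h
      funext i
      exact sub_eq_zero.1 (abs_eq_zero.1 (h i (Finset.mem_univ i)))) hη2
  -- Rounding moves each entry by at most `g` and the array by at most `D * g`. The four bounds keep
  -- it in the ball of radius ρ + 1, within the modulus of continuity, with columns still distinct,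
  -- and in the range of `ColumnCompatible`.
  obtain ⟨g, hg, hg1, hgδ, hgδ₂⟩ : ∃ g : ℝ, 0 < g ∧ D * g ≤ 1 ∧ D * g < δ ∧
      Fintype.card α * (2 * g) ≤ δ₂ ∧ g ≤ 1 := by
    obtain ⟨c, hc⟩ : ∃ c : ℝ, c = (Fintype.card α : ℝ) := ⟨_, rfl⟩
    rw [← hc]
    have hc0 : 0 ≤ c := hc ▸ Nat.cast_nonneg _
    refine ⟨min 1 (min δ δ₂) / (2 * (D + c + 1)), by positivity, ?_, ?_, ?_, ?_⟩
    all_goals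
      have h1 := min_le_left 1 (min δ δ₂)
      have h2 := (min_le_right 1 (min δ δ₂)).trans (min_le_left _ _)
      have h3 := (min_le_right 1 (min δ δ₂)).trans (min_le_right _ _)
      have h0 : 0 < min 1 (min δ δ₂) := by positivity
      set z := min 1 (min δ δ₂)
    · rw [mul_div_assoc', div_le_iff₀ (by positivity)]; nlinarith
    · rw [mul_div_assoc', div_lt_iff₀ (by positivity)]; nlinarith
    · rw [mul_div_assoc', mul_div_assoc', div_le_iff₀ (by positivity)]; nlinarith
    · rw [div_le_iff₀ (by positivity)]; nlinarith
  obtain ⟨hgδ₂, hg1'⟩ := hgδ₂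
  obtain ⟨c, hc⟩ := exists_offset μ (fun (q : α × β) (X : SeqSpace α β) => X q)
    (fun q => by fun_prop) g
  obtain ⟨δ₁, hδ₁, hbad₁⟩ := exists_measure_le_of_ae_pos (ι := α × β) μ
    (fun q X => min (Int.fract ((X q - c) / g)) (1 - Int.fract ((X q - c) / g)))
    (fun q => by
      have : Measurable fun X : SeqSpace α β => Int.fract ((X q - c) / g) :=
        measurable_fract.comp (by fun_prop)
      exact this.min (measurable_const.sub this)) (by
      intro q
      filter_upwards [hc q] with X hX
      refine lt_min (lt_of_le_of_ne (Int.fract_nonneg _) fun h => ?_)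
        (by linarith [Int.fract_lt_one ((X q - c) / g)])
      have h1 := Int.floor_add_fract ((X q - c) / g)
      rw [← h, add_zero, eq_div_iff hg.ne'] at h1
      exact hX ⌊(X q - c) / g⌋ (by linarith)) hη2
  let Y : ℝ → ℝ := fun x => c + g * ⌊(x - c) / g⌋
  have hY : ∀ x, |Y x - x| ≤ g := abs_grid_sub_le hg
  -- With mesh `g * δ₁`, any point whose fractional part is more than δ₁ away from 0 and 1 is
  -- interpolated from values in a single cell of the grid, so `Q` rounds it exactly.
  obtain ⟨Q, hQ, -, hQloc⟩ := exists_reluLine_local Y ρ (g := g * δ₁) (by positivity)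
  have hQY : ∀ x, |x| ≤ ρ → δ₁ < min (Int.fract ((x - c) / g)) (1 - Int.fract ((x - c) / g)) →
      Q x = Y x := by
    intro x hx hfr
    refine sub_eq_zero.1 (abs_nonpos_iff.1 (hQloc (Y x) 0 x hx fun y hy => ?_))
    have h1 : |(y - c) / g - (x - c) / g| ≤ δ₁ := by
      rw [← sub_div, abs_div, abs_of_pos hg, div_le_iff₀ hg]
      simpa [mul_comm] using hy
    simp only [Y, floor_eq_of_abs_sub_le hfr h1, sub_self, abs_zero, le_refl]
  let quant : SeqSpace α β → SeqSpace α β := fun X => WithLp.toLp 2 fun q => Y (X q)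
  have hquant : ∀ X q, |quant X q - X q| ≤ g := fun X q => hY (X q)
  let Good : Set (SeqSpace α β) := {X | ‖X‖ ≤ ρ ∧ X ∈ K ∧
    (∀ b b', b ≠ b' → δ₂ < ∑ i, |X (i, b) - X (i, b')|) ∧
    ∀ q, δ₁ < min (Int.fract ((X q - c) / g)) (1 - Int.fract ((X q - c) / g))}
  have hcoord : ∀ X : SeqSpace α β, ∀ q, |X q| ≤ ‖X‖ := fun X q => by
    simpa using PiLp.norm_apply_le X q
  have hqinj : ∀ X ∈ Good, Function.Injective (quant X).toMat.transpose := by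
    intro X hX b b' h
    by_contra hne
    have h1 := hX.2.2.1 b b' hne
    refine absurd h1 (not_lt.2 (le_trans ?_ hgδ₂))
    have h2 : ∀ i ∈ Finset.univ, |X (i, b) - X (i, b')| ≤ 2 * g := by
      intro i _
      have h3 : quant X (i, b) = quant X (i, b') := congrFun h i
      have h4 := hquant X (i, b)
      have h5 := hquant X (i, b')
      rw [abs_le] at *
      constructor <;> linarith
    simpa using Finset.sum_le_sum h2
  set 𝒰 : Set (Matrix α β ℝ) := (fun X => (quant X).toMat) '' Good with h𝒰
  have hfin : 𝒰.Finite := by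
    let V : Set ℝ := (fun k : ℤ => c + g * k) '' Set.Icc ⌊(-ρ - c) / g⌋ ⌊(ρ - c) / g⌋
    have hV : V.Finite := (Set.finite_Icc _ _).image _
    refine (Set.Finite.pi' (ι := α) fun _ => Set.Finite.pi' (ι := β) fun _ => hV).subset ?_
    rintro _ ⟨X, hX, rfl⟩ i b
    have h1 := abs_le.1 ((hcoord X (i, b)).trans hX.1)
    refine ⟨⌊(X (i, b) - c) / g⌋, ⟨?_, ?_⟩, rfl⟩ <;>
    · refine Int.floor_le_floor (div_le_div_of_nonneg_right ?_ hg.le)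
      linarith
  obtain ⟨t, ht, htC⟩ := exists_transformer_interp hfin
    (by rintro _ ⟨X, hX, rfl⟩; exact hqinj X hX)
    (fun U => (F (SeqSpace.ofMat U)).toMat) hC (fun U _ i b => hFC _ _) (by
      rintro _ ⟨X, hX, rfl⟩ _ ⟨X', hX', rfl⟩ b b' hr hbb i
      exact hcompat X hX.2.1 X' hX'.2.1 (quant X) (quant X') (fun q => (hquant X q).trans hg1')
        (fun q => (hquant X' q).trans hg1') (hqinj X hX) (hqinj X' hX') hr b b' hbb i)
  obtain ⟨B, hB⟩ := exists_block_tokenwise (β := β) (fun (x : α → ℝ) i => Q (x i)) (by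
      intro i
      simpa using reluLine.comp_affine hQ (Pi.single i 1) 0)
  refine ⟨B :: t, fun X q => htC _ _ _, ?_⟩
  have hgood : ∀ X ∈ Good, ‖F X - Transformer.apply (B :: t) X‖ < ε := by
    intro X hX
    have h1 : (Matrix.of fun i b => Q (X.toMat i b)) = (quant X).toMat := by
      ext i b
      exact hQY _ ((hcoord X (i, b)).trans hX.1) (hX.2.2.2 (i, b))
    have h2 : Transformer.apply (B :: t) X = F (quant X) := by
      rw [Transformer.apply, Transformer.applyMat_cons, hB, h1, ht _ ⟨X, hX, rfl⟩]
      rfl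
    have h3 : ‖quant X - X‖ ≤ D * g := hD ▸ euclidean_norm_le hg.le fun q => hquant X q
    rw [h2, ← dist_eq_norm]
    refine hFδ _ ?_ _ ?_ ?_
    · rw [mem_closedBall_zero_iff]; linarith [hX.1]
    · rw [mem_closedBall_zero_iff]
      have := norm_le_norm_add_norm_sub' (quant X) X
      linarith [hX.1]
    · rw [dist_comm, dist_eq_norm]; linarith
  have hsub : ∀ᵐ X ∂μ, X ∈ {X | ε ≤ ‖F X - Transformer.apply (B :: t) X‖} →
      X ∈ {X : SeqSpace α β | ∃ p : {p : β × β // p.1 ≠ p.2},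
        ∑ i, |X (i, p.1.1) - X (i, p.1.2)| ≤ δ₂} ∪ {X : SeqSpace α β | ∃ q,
        min (Int.fract ((X q - c) / g)) (1 - Int.fract ((X q - c) / g)) ≤ δ₁} := by
    filter_upwards [hρ, hK] with X h1 h2 h3
    by_contra h4
    simp only [Set.mem_union, Set.mem_ofPred_eq, not_or, not_exists, not_le] at h4
    exact absurd (hgood X ⟨h1, h2, fun b b' hne => h4.1 ⟨(b, b'), hne⟩, h4.2⟩) (not_lt.2 h3)
  calc μ {X | ε ≤ ‖F X - Transformer.apply (B :: t) X‖} ≤ _ := measure_mono_ae hsub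
    _ ≤ _ := measure_union_le _ _
    _ ≤ η / 2 + η / 2 := add_le_add hbad₂ hbad₁
    _ = η := ENNReal.add_halves η

/-! ### From approximation in measure to `L^p` -/

-- The function is at most δ off a set of measure at most δ and at most `C` on it; both
-- contributions to the norm vanish as δ tends to 0.
open MeasureTheory Filter Topology in
theorem exists_pos_eLpNorm_lt {Ω E : Type*} [MeasurableSpace Ω] [NormedAddCommGroup E]
    (ν : Measure Ω) [IsFiniteMeasure ν] (C : ℝ) {p : ℝ≥0∞} (hp : 1 ≤ p) (hp' : p ≠ ∞) {ε : ℝ}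
    (hε : 0 < ε) :
    ∃ δ > 0, ∀ e : Ω → E, (∀ᵐ x ∂ν, ‖e x‖ ≤ C) → ν {x | δ ≤ ‖e x‖} ≤ ENNReal.ofReal δ →
      eLpNorm e p ν < ENNReal.ofReal ε := by
  have hp0 : p ≠ 0 := (zero_lt_one.trans_le hp).ne'
  have hq : 0 < 1 / p.toReal := one_div_pos.2 (ENNReal.toReal_pos hp0 hp')
  set m : ℝ≥0∞ := ν Set.univ ^ (1 / p.toReal) with hm
  have hmtop : m ≠ ∞ := ENNReal.rpow_ne_top_of_nonneg hq.le (measure_ne_top _ _)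
  let φ : ℝ → ℝ≥0∞ := fun δ =>
    ENNReal.ofReal δ * m + ENNReal.ofReal C * ENNReal.ofReal δ ^ (1 / p.toReal)
  have hφ : Tendsto φ (𝓝[>] 0) (𝓝 0) := by
    have h0 : Tendsto (fun δ : ℝ => ENNReal.ofReal δ) (𝓝[>] 0) (𝓝 0) := by
      have := (ENNReal.continuous_ofReal.tendsto 0).mono_left
        (nhdsWithin_le_nhds (s := Set.Ioi (0 : ℝ)))
      simpa using this
    have h1 := ENNReal.Tendsto.mul_const h0 (b := m) (Or.inr hmtop)
    have h2 := (ENNReal.continuous_rpow_const (y := 1 / p.toReal)).tendsto 0 |>.comp h0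
    have h3 := ENNReal.Tendsto.const_mul h2 (a := ENNReal.ofReal C) (Or.inr ENNReal.ofReal_ne_top)
    have h4 := h1.add h3
    rw [ENNReal.zero_rpow_of_pos hq] at h4
    simpa [φ, Function.comp_def] using h4
  obtain ⟨δ, hδφ, hδ⟩ := ((hφ.eventually_lt_const (ENNReal.ofReal_pos.2 hε)).and
    self_mem_nhdsWithin).exists
  have hδ0 : 0 < δ := hδ
  refine ⟨δ, hδ0, fun e he hν => lt_of_le_of_lt ?_ hδφ⟩
  -- A measurable hull, since `e` is not assumed measurable.
  set A := toMeasurable ν {x | δ ≤ ‖e x‖} with hA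
  have hAm : MeasurableSet A := measurableSet_toMeasurable _ _
  calc eLpNorm e p ν
      ≤ eLpNorm ((fun _ => δ) + A.indicator (fun _ => C)) p ν := by
        refine eLpNorm_mono_ae_real ?_
        filter_upwards [he] with x hx
        by_cases hxA : x ∈ A
        · simp only [Pi.add_apply, Set.indicator_of_mem hxA]; linarith
        · have : x ∉ {x | δ ≤ ‖e x‖} := fun h => hxA (subset_toMeasurable _ _ h)
          simp only [Pi.add_apply, Set.indicator_of_notMem hxA, add_zero]
          exact (not_le.1 this).le
    _ ≤ eLpNorm (fun _ => δ) p ν + eLpNorm (A.indicator (fun _ => C)) p ν :=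
        eLpNorm_add_le aestronglyMeasurable_const
          (aestronglyMeasurable_const.indicator hAm) hp
    _ ≤ φ δ := by
        refine add_le_add ?_ ?_
        · rw [eLpNorm_const' _ hp0 hp']
          simp [Real.enorm_eq_ofReal hδ0.le, hm]
        · by_cases hC : 0 ≤ C
          · refine (eLpNorm_indicator_const_le _ _).trans ?_
            rw [Real.enorm_eq_ofReal hC, hA, measure_toMeasurable]
            gcongr
          · have hnull : ν A = 0 := by
              rw [hA, measure_toMeasurable]
              have : ∀ᵐ x ∂ν, False := by
                filter_upwards [he] with x hx
                exact hC ((norm_nonneg _).trans hx)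
              exact measure_mono_null (Set.subset_univ _) (by simpa [ae_iff] using this)
            refine (eLpNorm_indicator_const_le _ _).trans ?_
            rw [hnull, ENNReal.zero_rpow_of_pos hq, mul_zero]
            exact zero_le

open MeasureTheory in
/-- If `f` can be approximated in measure by uniformly bounded elements of a family `𝒯`, for all
finite measures on `B` for which almost all points are in `G`, then it can be approximated
simultaneously in `L^p`, at finitely many points of `G`, and in measure. -/
theorem exists_mem_approx {E E' : Type} [MeasurableSpace E] [MeasurableSingletonClass E]
    [NormedAddCommGroup E'] {vol : Measure E} {B G : Set E} (hB : MeasurableSet B)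
    (hvol : vol B ≠ ∞) (hG : ∀ᵐ X ∂(vol.restrict B), X ∈ G)
    {f : E → E'} {𝒯 : Set (E → E')} {C : ℝ}
    (h : ∀ μ : Measure E, IsFiniteMeasure μ → (∀ᵐ X ∂μ, X ∈ B) → (∀ᵐ X ∂μ, X ∈ G) →
      ∀ ε : ℝ, 0 < ε → ∀ η : ℝ≥0∞, η ≠ 0 → ∃ g ∈ 𝒯, (∀ X ∈ B, ‖f X - g X‖ ≤ C) ∧
        μ {X | X ∈ B ∧ ε ≤ ‖f X - g X‖} ≤ η)
    {p : ℝ≥0∞} (hp : 1 ≤ p) (hp' : p ≠ ∞) {ε : ℝ} (hε : 0 < ε) (P : Finset E)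
    (hP : ∀ X ∈ P, X ∈ B ∧ X ∈ G) (ν : Measure E) [IsFiniteMeasure ν] (hνB : ∀ᵐ X ∂ν, X ∈ B)
    (hνG : ∀ᵐ X ∂ν, X ∈ G) :
    ∃ g ∈ 𝒯, (∀ X ∈ B, ‖f X - g X‖ ≤ C) ∧
      eLpNorm (fun X => f X - g X) p (vol.restrict B) < ENNReal.ofReal ε ∧
      (∀ X ∈ P, ‖f X - g X‖ < ε) ∧
      ν {X | X ∈ B ∧ ε ≤ ‖f X - g X‖} ≤ ENNReal.ofReal ε := by
  have hfin : IsFiniteMeasure (vol.restrict B) := ⟨by simpa using hvol.lt_top⟩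
  obtain ⟨δ, hδ, hLp⟩ := exists_pos_eLpNorm_lt (E := E') (vol.restrict B) C hp hp' hε
  let π : Measure E := ∑ X ∈ P, Measure.dirac X
  have hπ : ∀ s : Set E, (∀ X ∈ P, X ∈ s) → ∀ᵐ X ∂π, X ∈ s := by
    intro s hs
    rw [ae_iff, Measure.finsetSum_apply]
    refine Finset.sum_eq_zero fun X hX => ?_
    have : ∀ᵐ Y ∂(Measure.dirac X), Y ∈ s := by
      rw [ae_dirac_eq]
      exact hs X hX
    exact ae_iff.1 this
  -- Each point of `P` has mass at least 1 for the sum of the measures. An exceptional set of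
  -- measure at most 1/2 therefore misses `P`, and closeness in measure is genuine closeness at
  -- these points.
  obtain ⟨g, hg, hgC, hgμ⟩ := h (vol.restrict B + ν + π) inferInstance
    (by
      rw [ae_add_measure_iff, ae_add_measure_iff]
      exact ⟨⟨ae_restrict_mem hB, hνB⟩, hπ B fun X hX => (hP X hX).1⟩)
    (by
      rw [ae_add_measure_iff, ae_add_measure_iff]
      exact ⟨⟨hG, hνG⟩, hπ G fun X hX => (hP X hX).2⟩)
    (min δ ε) (lt_min hδ hε) (min (ENNReal.ofReal (min δ ε)) (1 / 2)) (by
      simp [hδ, hε])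
  have hη1 : min (ENNReal.ofReal (min δ ε)) (1 / 2) ≤ ENNReal.ofReal δ :=
    (min_le_left _ _).trans (ENNReal.ofReal_le_ofReal (min_le_left _ _))
  have hη2 : min (ENNReal.ofReal (min δ ε)) (1 / 2) ≤ ENNReal.ofReal ε :=
    (min_le_left _ _).trans (ENNReal.ofReal_le_ofReal (min_le_right _ _))
  simp only [Measure.coe_add, Pi.add_apply] at hgμ
  refine ⟨g, hg, hgC, hLp _ ?_ ?_, fun X hX => ?_, ?_⟩
  · filter_upwards [ae_restrict_mem hB] with X hX using hgC X hX
  · refine le_trans (measure_mono_ae (t := {X | X ∈ B ∧ min δ ε ≤ ‖f X - g X‖}) ?_)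
      ((le_self_add.trans le_self_add).trans (hgμ.trans hη1))
    filter_upwards [ae_restrict_mem hB] with X hX h
    exact ⟨hX, (min_le_left _ _).trans h⟩
  · by_contra hc
    have hmem : X ∈ {X | X ∈ B ∧ min δ ε ≤ ‖f X - g X‖} :=
      ⟨(hP X hX).1, (min_le_right _ _).trans (not_lt.1 hc)⟩
    have h1 : (1 : ℝ≥0∞) ≤ π {X | X ∈ B ∧ min δ ε ≤ ‖f X - g X‖} := by
      rw [← Measure.dirac_apply_of_mem hmem]
      simp only [π, Measure.finsetSum_apply]
      exact Finset.single_le_sum (f := fun X => Measure.dirac X _) (fun _ _ => zero_le) hX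
    have h2 := (h1.trans le_add_self).trans (hgμ.trans (min_le_right _ _))
    exact absurd h2 (by norm_num)
  · refine le_trans (measure_mono (t := {X | X ∈ B ∧ min δ ε ≤ ‖f X - g X‖})
      fun X hX => ⟨hX.1, (min_le_right _ _).trans hX.2⟩)
      ((le_add_self.trans le_self_add).trans (hgμ.trans hη2))

/-! ### Extension from the ball -/

/-- The radial retraction onto the closed ball of radius `R`. -/
noncomputable def ballRetract {E : Type} [NormedAddCommGroup E] [NormedSpace ℝ E] (R : ℝ) (x : E) :
    E :=
  (R / max R ‖x‖) • x

theorem continuous_ballRetract {E : Type} [NormedAddCommGroup E] [NormedSpace ℝ E] {R : ℝ}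
    (hR : 0 ≤ R) : Continuous (ballRetract R : E → E) := by
  rcases hR.eq_or_lt with rfl | hR
  · have : (ballRetract 0 : E → E) = fun _ => 0 := by funext x; simp [ballRetract]
    rw [this]
    exact continuous_const
  · unfold ballRetract
    refine Continuous.smul (Continuous.div continuous_const (by fun_prop) fun x => ?_) continuous_id
    exact (lt_max_of_lt_left hR).ne'

theorem ballRetract_mem {E : Type} [NormedAddCommGroup E] [NormedSpace ℝ E] {R : ℝ}
    (hR : 0 ≤ R) (x : E) : ballRetract R x ∈ Metric.closedBall (0 : E) R := by
  rw [mem_closedBall_zero_iff, ballRetract, norm_smul, Real.norm_of_nonneg (by positivity)]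
  rcases hR.eq_or_lt with rfl | hR
  · simp
  · rw [div_mul_eq_mul_div, div_le_iff₀ (lt_max_of_lt_left hR)]
    exact mul_le_mul_of_nonneg_left (le_max_right _ _) hR.le

theorem ballRetract_eq_self {E : Type} [NormedAddCommGroup E] [NormedSpace ℝ E] {R : ℝ} {x : E}
    (hx : x ∈ Metric.closedBall (0 : E) R) : ballRetract R x = x := by
  rw [mem_closedBall_zero_iff] at hx
  rw [ballRetract, max_eq_left hx]
  rcases (norm_nonneg x |>.trans hx).eq_or_lt with rfl | hR
  · rw [norm_le_zero_iff.1 hx, smul_zero]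
  · rw [div_self hR.ne', one_smul]

theorem norm_permCols {α β : Type} [Fintype α] [Fintype β] (σ : Equiv.Perm β) (X : SeqSpace α β) :
    ‖permCols σ X‖ = ‖X‖ := by
  rw [EuclideanSpace.norm_eq, EuclideanSpace.norm_eq]
  congr 1
  exact Equiv.sum_comp (Equiv.prodCongr (Equiv.refl α) σ) fun q => ‖X q‖ ^ 2

/-- Precompose with the radial retraction. Column permutations preserve the norm and so commute with
it, which preserves equivariance. -/
theorem exists_continuous_extension {α β : Type} [Fintype α] [Fintype β] {R : ℝ} (hR : 0 ≤ R)
    {f : SeqSpace α β → SeqSpace α β} (hf : ContinuousOn f (Metric.closedBall 0 R)) :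
    ∃ F : SeqSpace α β → SeqSpace α β, Continuous F ∧ Set.EqOn F f (Metric.closedBall 0 R) ∧
      (∃ C, 0 ≤ C ∧ ∀ X q, |F X q| ≤ C) ∧
      ((∀ (σ : Equiv.Perm β) (X), X ∈ Metric.closedBall 0 R →
        f (permCols σ X) = permCols σ (f X)) →
        ∀ (σ : Equiv.Perm β) (X), F (permCols σ X) = permCols σ (F X)) := by
  refine ⟨fun X => f (ballRetract R X),
    hf.comp_continuous (continuous_ballRetract hR) (ballRetract_mem hR),
    fun X hX => by simp only [ballRetract_eq_self hX], ?_, fun h σ X => ?_⟩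
  · obtain ⟨C, hC⟩ := (isCompact_closedBall (0 : SeqSpace α β) R).exists_bound_of_continuousOn hf
    refine ⟨max C 0, le_max_right _ _, fun X q => ?_⟩
    have h1 := hC _ (ballRetract_mem hR X)
    have h2 : |f (ballRetract R X) q| ≤ ‖f (ballRetract R X)‖ := by
      simpa using PiLp.norm_apply_le (f (ballRetract R X)) q
    exact h2.trans (h1.trans (le_max_left _ _))
  · rw [← h σ _ (ballRetract_mem hR X)]
    simp only [ballRetract, norm_permCols]
    rfl

/-! ### Universal approximation by Transformers -/

-- After adding the encoding, each column reveals its position. The set of columns then determines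
-- the whole array, and column compatibility holds for any function.
open MeasureTheory in
theorem exists_transformerPE_measure_le {α β : Type} [Fintype α] [Fintype β] [Nonempty α]
    {R : ℝ} (hR : 0 ≤ R) {f : SeqSpace α β → SeqSpace α β}
    (hf : ContinuousOn f (Metric.closedBall 0 R)) :
    ∃ C : ℝ, ∀ μ : Measure (SeqSpace α β), IsFiniteMeasure μ →
      (∀ᵐ X ∂μ, X ∈ Metric.closedBall (0 : SeqSpace α β) R) →
      ∀ ε : ℝ, 0 < ε → ∀ η : ℝ≥0∞, η ≠ 0 →
      ∃ g ∈ {g : SeqSpace α β → SeqSpace α β |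
          ∃ (t : Transformer α) (E : SeqSpace α β), g = t.applyPE E},
        (∀ X ∈ Metric.closedBall (0 : SeqSpace α β) R, ‖f X - g X‖ ≤ C) ∧
        μ {X | X ∈ Metric.closedBall (0 : SeqSpace α β) R ∧ ε ≤ ‖f X - g X‖} ≤ η := by
  classical
  obtain ⟨F, hF, hFf, ⟨C, hC, hFC⟩, -⟩ := exists_continuous_extension hR hf
  refine ⟨Fintype.card (α × β) * (2 * C), fun μ hμ hB ε hε η hη => ?_⟩
  -- Entries of arrays within 1 of the shifted ball deviate from `E` by at most R + 1. A spacing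
  -- above 2 (R + 1) keeps the ranges of different positions disjoint.
  let E : SeqSpace α β := WithLp.toLp 2 fun q => (2 * R + 4) * (Fintype.equivFin β q.2 : ℕ)
  have hE : ∀ q, E q = (2 * R + 4) * (Fintype.equivFin β q.2 : ℕ) := fun q => rfl
  have hemb : MeasurableEmbedding fun X : SeqSpace α β => X + E := measurableEmbedding_addRight E
  have hcoord : ∀ X : SeqSpace α β, ∀ q, |X q| ≤ ‖X‖ := fun X q => by
    simpa using PiLp.norm_apply_le X q
  have hsep : ∀ (U U' : SeqSpace α β) (b b' : β), (∀ q, |U q - E q| ≤ R + 1) →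
      (∀ q, |U' q - E q| ≤ R + 1) → U.toMat.transpose b = U'.toMat.transpose b' → b = b' := by
    intro U U' b b' hU hU' h
    obtain ⟨i⟩ := ‹Nonempty α›
    have h1 := hU (i, b)
    have h2 := hU' (i, b')
    have h3 : U (i, b) = U' (i, b') := congrFun h i
    rw [hE, h3] at h1
    rw [hE] at h2
    rw [abs_le] at h1 h2
    by_contra hne
    have hne' : (Fintype.equivFin β b : ℕ) ≠ Fintype.equivFin β b' := fun h' =>
      hne ((Fintype.equivFin β).injective (Fin.ext h'))
    rcases lt_or_gt_of_ne hne' with hlt | hlt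
    · have : ((Fintype.equivFin β b : ℕ) : ℝ) + 1 ≤ (Fintype.equivFin β b' : ℕ) := by
        exact_mod_cast hlt
      simp only at h1 h2
      nlinarith
    · have : ((Fintype.equivFin β b' : ℕ) : ℝ) + 1 ≤ (Fintype.equivFin β b : ℕ) := by
        exact_mod_cast hlt
      simp only at h1 h2
      nlinarith
  have hnear : ∀ X ∈ Metric.closedBall (0 : SeqSpace α β) R, ∀ U : SeqSpace α β,
      (∀ q, |U q - (X + E) q| ≤ 1) → ∀ q, |U q - E q| ≤ R + 1 := by
    intro X hX U hU q
    have h1 := hU q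
    have h2 := (hcoord X q).trans (mem_closedBall_zero_iff.1 hX)
    rw [PiLp.add_apply] at h1
    rw [abs_le] at *
    constructor <;> linarith
  obtain ⟨t, htC, ht⟩ := exists_transformer_measure_le (μ.map fun X => X + E) (ρ := R + ‖E‖)
    (by
      rw [hemb.ae_map_iff]
      filter_upwards [hB] with X hX
      exact (norm_add_le _ _).trans (by simpa using hX))
    (by
      rw [hemb.ae_map_iff]
      filter_upwards [hB] with X hX b b' h
      have h1 := hnear X hX (X + E) (fun q => by simp)
      exact hsep _ _ _ _ h1 h1 h)
    (F := fun Y => F (Y - E)) (by fun_prop) hC (fun X q => hFC _ _)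
    (K := (fun X => X + E) '' Metric.closedBall 0 R)
    (by
      rw [hemb.ae_map_iff]
      filter_upwards [hB] with X hX using ⟨X, hX, rfl⟩)
    (by
      rintro _ ⟨X, hX, rfl⟩ _ ⟨X', hX', rfl⟩ U U' hU hU' - - hr b b' hb i
      have h1 := hnear X hX U hU
      have h2 := hnear X' hX' U' hU'
      have hUU : U = U' := by
        ext ⟨i, b⟩
        obtain ⟨b', hb'⟩ : U.toMat.transpose b ∈ Set.range U'.toMat.transpose :=
          hr ▸ Set.mem_range_self b
        have := hsep _ _ _ _ h2 h1 hb'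
        subst this
        exact (congrFun hb' i).symm
      rw [hUU, hsep _ _ _ _ h1 h2 hb]) hε hη
  rw [hemb.map_apply] at ht
  refine ⟨_, ⟨t, E, rfl⟩, fun X hX => ?_, ?_⟩
  · refine euclidean_norm_le (by linarith) fun q => ?_
    have h1 := hFC X q
    have h2 := htC (X + E) q
    rw [hFf hX] at h1
    rw [PiLp.sub_apply, Transformer.applyPE]
    rw [abs_le] at *
    constructor <;> linarith
  · refine le_trans (measure_mono fun X hX => ?_) ht
    have h1 := hX.2
    rw [← hFf hX.1] at h1
    simpa [Transformer.applyPE] using h1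

/-- Two arrays with distinct columns and the same set of columns differ by a permutation of the
columns. -/
theorem columnCompatible_of_equivariant {α β : Type} [Fintype α] [Fintype β]
    {F : SeqSpace α β → SeqSpace α β}
    (hF : ∀ (σ : Equiv.Perm β) (X), F (permCols σ X) = permCols σ (F X)) :
    ColumnCompatible Set.univ F := by
  intro _ _ _ _ U U' _ _ hU hU' hr b b' hb i
  have h : ∀ c, ∃ c', U.toMat.transpose c' = U'.toMat.transpose c := fun c => by
    have : U'.toMat.transpose c ∈ Set.range U.toMat.transpose := hr ▸ Set.mem_range_self c
    exact this
  choose s hs using h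
  have hinj : Function.Injective s := fun c c' hc => hU' (by rw [← hs c, ← hs c', hc])
  let σ : Equiv.Perm β := Equiv.ofBijective s (Finite.injective_iff_bijective.1 hinj)
  have hσ : U' = permCols σ U := by
    ext ⟨i, c⟩
    exact (congrFun (hs c) i).symm
  have hb' : σ b' = b := hU ((hs b').trans hb.symm)
  rw [hσ, hF]
  change _ = F U (i, σ b')
  rw [hb']

open MeasureTheory in
theorem exists_transformer_equivariant_measure_le {α β : Type} [Fintype α] [Fintype β]
    [Nonempty α] {R : ℝ} (hR : 0 ≤ R) {f : SeqSpace α β → SeqSpace α β}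
    (hf : ContinuousOn f (Metric.closedBall 0 R))
    (hσ : ∀ (σ : Equiv.Perm β) (X), X ∈ Metric.closedBall 0 R →
      f (permCols σ X) = permCols σ (f X)) :
    ∃ C : ℝ, ∀ μ : Measure (SeqSpace α β), IsFiniteMeasure μ →
      (∀ᵐ X ∂μ, X ∈ Metric.closedBall (0 : SeqSpace α β) R) →
      (∀ᵐ X ∂μ, X ∈ {X : SeqSpace α β | Function.Injective X.toMat.transpose}) →
      ∀ ε : ℝ, 0 < ε → ∀ η : ℝ≥0∞, η ≠ 0 →
      ∃ g ∈ {g : SeqSpace α β → SeqSpace α β | ∃ t : Transformer α, g = t.apply},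
        (∀ X ∈ Metric.closedBall (0 : SeqSpace α β) R, ‖f X - g X‖ ≤ C) ∧
        μ {X | X ∈ Metric.closedBall (0 : SeqSpace α β) R ∧ ε ≤ ‖f X - g X‖} ≤ η := by
  obtain ⟨F, hF, hFf, ⟨C, hC, hFC⟩, hFσ⟩ := exists_continuous_extension hR hf
  refine ⟨Fintype.card (α × β) * (2 * C), fun μ hμ hB hG ε hε η hη => ?_⟩
  obtain ⟨t, htC, ht⟩ := exists_transformer_measure_le μ (ρ := R)
    (by filter_upwards [hB] with X hX using mem_closedBall_zero_iff.1 hX) hG hF hC hFC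
    (K := Set.univ) (by simp) (columnCompatible_of_equivariant (hFσ hσ)) hε hη
  refine ⟨_, ⟨t, rfl⟩, fun X hX => ?_, ?_⟩
  · refine euclidean_norm_le (by linarith) fun q => ?_
    have h1 := hFC X q
    have h2 := htC X q
    rw [hFf hX] at h1
    rw [PiLp.sub_apply]
    rw [abs_le] at *
    constructor <;> linarith
  · refine le_trans (measure_mono fun X hX => ?_) ht
    have h1 := hX.2
    rw [← hFf hX.1] at h1
    exact h1

-- Arrays with two equal columns lie in finitely many proper subspaces, which are null sets.
open MeasureTheory in
theorem ae_injective_columns {α β : Type} [Fintype α] [Fintype β] [Nonempty α] :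
    ∀ᵐ X : SeqSpace α β, Function.Injective X.toMat.transpose := by
  classical
  obtain ⟨i⟩ := ‹Nonempty α›
  have h : ∀ p : β × β, ∀ᵐ X : SeqSpace α β, p.1 ≠ p.2 → X (i, p.1) ≠ X (i, p.2) := by
    rintro ⟨b, b'⟩
    by_cases hne : b = b'
    · simp [hne]
    let l : SeqSpace α β →ₗ[ℝ] ℝ :=
      (EuclideanSpace.proj (i, b) - EuclideanSpace.proj (i, b') : SeqSpace α β →L[ℝ] ℝ)
    have hl : ∀ X, l X = X (i, b) - X (i, b') := fun X => rfl
    have h0 := Measure.addHaar_submodule (volume : Measure (SeqSpace α β)) (LinearMap.ker l) (by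
      intro htop
      have h1 : EuclideanSpace.single (i, b) (1 : ℝ) ∈ LinearMap.ker l := htop ▸ Submodule.mem_top
      rw [LinearMap.mem_ker, hl] at h1
      simp [hne] at h1)
    refine measure_mono_null (fun X hX => ?_) h0
    simp only [Set.mem_compl_iff, Set.mem_ofPred_eq, not_forall, not_not] at hX
    obtain ⟨_, hX⟩ := hX
    change l X = 0
    rw [hl, hX, sub_self]
  filter_upwards [ae_all_iff.2 h] with X hX b b' hb
  by_contra hne
  exact hX (b, b') hne (congrFun hb i)

open MeasureTheory in
/-- Approximation by Transformers with positional encoding in `L^p`, at finitely many points, and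
in measure. -/
theorem exists_transformerPE_approx {α β : Type} [Fintype α] [Fintype β] [Nonempty α]
    {R : ℝ} (hR : 0 ≤ R) {f : SeqSpace α β → SeqSpace α β}
    (hf : ContinuousOn f (Metric.closedBall 0 R)) :
    ∃ C : ℝ, ∀ p : ℝ≥0∞, 1 ≤ p → p ≠ ∞ → ∀ ε : ℝ, 0 < ε → ∀ P : Finset (SeqSpace α β),
      (∀ X ∈ P, X ∈ Metric.closedBall 0 R) → ∀ ν : Measure (SeqSpace α β), IsFiniteMeasure ν →
      (∀ᵐ X ∂ν, X ∈ Metric.closedBall (0 : SeqSpace α β) R) →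
      ∃ (t : Transformer α) (E : SeqSpace α β),
        (∀ X ∈ Metric.closedBall (0 : SeqSpace α β) R, ‖f X - t.applyPE E X‖ ≤ C) ∧
        eLpNorm (fun X => f X - t.applyPE E X) p
          (volume.restrict (Metric.closedBall 0 R)) < ENNReal.ofReal ε ∧
        (∀ X ∈ P, ‖f X - t.applyPE E X‖ < ε) ∧
        ν {X | X ∈ Metric.closedBall (0 : SeqSpace α β) R ∧ ε ≤ ‖f X - t.applyPE E X‖}
          ≤ ENNReal.ofReal ε := by
  obtain ⟨C, h⟩ := exists_transformerPE_measure_le hR hf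
  refine ⟨C, fun p hp hp' ε hε P hP ν hν hνB => ?_⟩
  obtain ⟨_, ⟨t, E, rfl⟩, h1⟩ := exists_mem_approx (G := Set.univ) (vol := volume)
    Metric.isClosed_closedBall.measurableSet measure_closedBall_lt_top.ne (by simp)
    (fun μ hμ hB _ => h μ hμ hB) hp hp' hε P (fun X hX => ⟨hP X hX, trivial⟩) ν hνB (by simp)
  exact ⟨t, E, h1⟩

open MeasureTheory in
/-- Approximation of equivariant functions by Transformers in `L^p` and at finitely many points
with distinct columns. -/
theorem exists_transformer_equivariant_approx {α β : Type} [Fintype α] [Fintype β] [Nonempty α]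
    {R : ℝ} (hR : 0 ≤ R) {f : SeqSpace α β → SeqSpace α β}
    (hf : ContinuousOn f (Metric.closedBall 0 R))
    (hσ : ∀ (σ : Equiv.Perm β) (X), X ∈ Metric.closedBall 0 R →
      f (permCols σ X) = permCols σ (f X))
    {p : ℝ≥0∞} (hp : 1 ≤ p) (hp' : p ≠ ∞) {ε : ℝ} (hε : 0 < ε) (P : Finset (SeqSpace α β))
    (hP : ∀ X ∈ P, X ∈ Metric.closedBall 0 R ∧ Function.Injective X.toMat.transpose) :
    ∃ t : Transformer α,
      eLpNorm (fun X => f X - t.apply X) p (volume.restrict (Metric.closedBall 0 R))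
        < ENNReal.ofReal ε ∧
      ∀ X ∈ P, ‖f X - t.apply X‖ < ε := by
  obtain ⟨C, h⟩ := exists_transformer_equivariant_measure_le hR hf hσ
  obtain ⟨_, ⟨t, rfl⟩, -, h1, h2, -⟩ := exists_mem_approx
    (G := {X : SeqSpace α β | Function.Injective X.toMat.transpose}) (vol := volume)
    Metric.isClosed_closedBall.measurableSet measure_closedBall_lt_top.ne
    (ae_restrict_of_ae ae_injective_columns) h hp hp' hε P hP 0 (by simp) (by simp)
  exact ⟨t, h1, h2⟩

/-! ### Isomorphism classes -/

/-- A number that determines the isomorphism class of a graph. -/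
theorem exists_isoCode : ∃ code : (Σ n, SimpleGraph (Fin n)) → ℕ,
    ∀ G H, code G = code H ↔ Nonempty (G.2 ≃g H.2) := by
  let s : Setoid (Σ n, SimpleGraph (Fin n)) :=
    { r := fun G H => Nonempty (G.2 ≃g H.2)
      iseqv := ⟨fun _ => ⟨SimpleGraph.Iso.refl⟩, fun ⟨e⟩ => ⟨e.symm⟩,
        fun ⟨e⟩ ⟨e'⟩ => ⟨e'.comp e⟩⟩ }
  obtain ⟨f, hf⟩ := exists_injective_nat (Quotient s)
  exact ⟨fun G => f ⟦G⟧, fun G H => hf.eq_iff.trans Quotient.eq⟩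

theorem finite_graphs (N : ℕ) : {G : Σ n, SimpleGraph (Fin n) | G.1 ≤ N}.Finite := by
  have : {G : Σ n, SimpleGraph (Fin n) | G.1 ≤ N} =
      ⋃ n ∈ Set.Iic N, Set.range (fun G : SimpleGraph (Fin n) => (⟨n, G⟩ : Σ n, SimpleGraph (Fin n))) := by
    ext ⟨n, G⟩
    simp only [Set.mem_ofPred_eq, Set.mem_iUnion, Set.mem_range, Set.mem_Iic, exists_prop]
    constructor
    · exact fun h => ⟨n, h, G, rfl⟩
    · rintro ⟨n', h, G', h'⟩
      cases h'
      exact h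
  rw [this]
  exact (Set.finite_Iic N).biUnion fun n _ => Set.finite_range _

/-- Continuous interpolation on a finite set. -/
theorem exists_continuous_interp {X : Type} [MetricSpace X] {Z : Set X} (hZ : Z.Finite)
    (c : X → ℝ) : ∃ h : X → ℝ, Continuous h ∧ ∀ z ∈ Z, h z = c z := by
  classical
  refine ⟨fun x => ∑ z ∈ hZ.toFinset, c z * ∏ z' ∈ hZ.toFinset.erase z, dist x z' / dist z z',
    by fun_prop, fun z hz => ?_⟩
  have hz' := hZ.mem_toFinset.2 hz
  simp only
  rw [Finset.sum_eq_single_of_mem z hz']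
  · rw [Finset.prod_eq_one, mul_one]
    intro z' hz''
    exact div_self (dist_ne_zero.2 (Finset.ne_of_mem_erase hz'').symm)
  · intro w _ hwz
    rw [Finset.prod_eq_zero (i := z) (Finset.mem_erase.2 ⟨hwz.symm, hz'⟩) (by simp), mul_zero]

/-- If `I` determines graphs up to isomorphism, then a continuous function of `I` computes a given
code of the isomorphism class, on graphs with at most `N` nodes. -/
theorem exists_continuous_code {X : Type} [MetricSpace X] (N : ℕ)
    (I : (Σ n, SimpleGraph (Fin n)) → X) (code : (Σ n, SimpleGraph (Fin n)) → ℝ)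
    (hI : ∀ G H, G.1 ≤ N → H.1 ≤ N → I G = I H → code G = code H) :
    ∃ h : X → ℝ, Continuous h ∧ ∀ G, G.1 ≤ N → h (I G) = code G := by
  classical
  let c : X → ℝ := fun x => if hx : ∃ G, G.1 ≤ N ∧ I G = x then code hx.choose else 0
  obtain ⟨h, hh, hc⟩ := exists_continuous_interp ((finite_graphs N).image I) c
  refine ⟨h, hh, fun G hG => ?_⟩
  have hx : ∃ G', G'.1 ≤ N ∧ I G' = I G := ⟨G, hG, rfl⟩
  rw [hc _ ⟨G, hG, rfl⟩]
  simp only [c, dif_pos hx]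
  exact hI _ _ hx.choose_spec.1 hG hx.choose_spec.2

/-! ### Matrices of graphs, padded with zeros -/

/-- A square matrix padded with zeros. -/
noncomputable def padMatrix (N : ℕ) {n : ℕ} (A : Matrix (Fin n) (Fin n) ℝ) (q : Fin N × Fin N) :
    ℝ :=
  if h : (q.1 : ℕ) < n ∧ (q.2 : ℕ) < n then A ⟨q.1, h.1⟩ ⟨q.2, h.2⟩ else 0

theorem padMatrix_apply {N n : ℕ} (hn : n ≤ N) (A : Matrix (Fin n) (Fin n) ℝ) (u v : Fin n) :
    padMatrix N A (Fin.castLE hn u, Fin.castLE hn v) = A u v := by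
  simp [padMatrix]

/-- The first diagonal entry in the padding of the smaller matrix is zero, but nonzero in the larger
one. This is why the identity is added to the Laplacian and adjacency matrices. -/
theorem eq_of_padMatrix_eq {N n₁ n₂ : ℕ} (h₁ : n₁ ≤ N) (h₂ : n₂ ≤ N)
    {A₁ : Matrix (Fin n₁) (Fin n₁) ℝ} {A₂ : Matrix (Fin n₂) (Fin n₂) ℝ}
    (hA₁ : ∀ u, A₁ u u ≠ 0) (hA₂ : ∀ u, A₂ u u ≠ 0) (h : padMatrix N A₁ = padMatrix N A₂) :
    n₁ = n₂ := by
  by_contra hne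
  rcases lt_or_gt_of_ne hne with hlt | hlt
  · have h3 := congrFun h (⟨n₁, by omega⟩, ⟨n₁, by omega⟩)
    simp only [padMatrix, lt_irrefl, and_self, dif_neg, not_false_eq_true, hlt, dif_pos] at h3
    exact hA₂ _ h3.symm
  · have h3 := congrFun h (⟨n₂, by omega⟩, ⟨n₂, by omega⟩)
    simp only [padMatrix, lt_irrefl, and_self, dif_neg, not_false_eq_true, hlt, dif_pos] at h3
    exact hA₁ _ h3

open Classical in
/-- Identity plus Laplacian matrix of a graph, padded with zeros. -/
noncomputable def lapInput (N : ℕ) (G : Σ n, SimpleGraph (Fin n)) : Fin N × Fin N → ℝ :=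
  padMatrix N (G.2.lapMatrix ℝ + 1)

theorem nonempty_iso_of_padMatrix {N : ℕ} (A : ∀ n, SimpleGraph (Fin n) → Matrix (Fin n) (Fin n) ℝ)
    (hdiag : ∀ n G u, A n G u u ≠ 0)
    (hadj : ∀ n (G : SimpleGraph (Fin n)) u v, u ≠ v → (A n G u v ≠ 0 ↔ G.Adj u v))
    {G H : Σ n, SimpleGraph (Fin n)} (hG : G.1 ≤ N) (hH : H.1 ≤ N)
    (h : padMatrix N (A _ G.2) = padMatrix N (A _ H.2)) : Nonempty (G.2 ≃g H.2) := by
  obtain ⟨n, G⟩ := G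
  obtain ⟨n', H⟩ := H
  obtain rfl : n = n' := eq_of_padMatrix_eq hG hH (hdiag _ _) (hdiag _ _) h
  have hGH : G = H := by
    ext u v
    by_cases huv : u = v
    · simp [huv]
    · have h1 := congrFun h (Fin.castLE hG u, Fin.castLE hG v)
      rw [padMatrix_apply, padMatrix_apply] at h1
      rw [← hadj n G u v huv, ← hadj n H u v huv, h1]
  subst hGH
  exact ⟨SimpleGraph.Iso.refl⟩

theorem nonempty_iso_of_lapInput {N : ℕ} {G H : Σ n, SimpleGraph (Fin n)} (hG : G.1 ≤ N)
    (hH : H.1 ≤ N) (h : lapInput N G = lapInput N H) : Nonempty (G.2 ≃g H.2) := by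
  classical
  refine nonempty_iso_of_padMatrix (fun n G => G.lapMatrix ℝ + 1) ?_ ?_ hG hH h
  · intro n G u
    have : (0 : ℝ) < G.degree u + 1 := by positivity
    simpa [SimpleGraph.lapMatrix, SimpleGraph.degMatrix] using this.ne'
  · intro n G u v huv
    simp [SimpleGraph.lapMatrix, SimpleGraph.degMatrix, huv, SimpleGraph.adjMatrix_apply]

theorem nonempty_iso_of_nodeInput {N : ℕ} {G H : Σ n, SimpleGraph (Fin n)} (hG : G.1 ≤ N)
    (hH : H.1 ≤ N) (h : nodeInput N G.2 = nodeInput N H.2) : Nonempty (G.2 ≃g H.2) := by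
  classical
  refine nonempty_iso_of_padMatrix (fun n G => 1 + G.adjMatrix ℝ) ?_ ?_ hG hH ?_
  · intro n G u
    simp
  · intro n G u v huv
    simp [huv, SimpleGraph.adjMatrix_apply]
  · funext q
    exact congrArg (fun X : SeqSpace (Fin N) (Fin N) => X q) h

/-- Spectral decomposition of L + I. The padding contributes nothing, as its eigenvector entries
vanish; N ≤ m ensures that no eigenpair is cut off. -/
theorem lapInput_eq_of_mem_lapReps {N m n : ℕ} (hn : n ≤ N) (hm : N ≤ m)
    {G : SimpleGraph (Fin n)} {T : LPEInput N m} (hT : T ∈ lapReps N m G) :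
    (fun q : Fin N × Fin N => ∑ i, (T ((q.1, 0), i) + 1) * T ((q.1, 1), i) * T ((q.2, 1), i)) =
      lapInput N ⟨n, G⟩ := by
  classical
  obtain ⟨lam, φ, -, hφ, hT⟩ := hT
  funext ⟨j, j'⟩
  simp only [lapInput, padMatrix]
  split_ifs with h
  · have hsum : ∑ i, (T ((j, 0), i) + 1) * T ((j, 1), i) * T ((j', 1), i) =
        ∑ i : Fin n, (lam i + 1) * φ i ⟨j, h.1⟩ * φ i ⟨j', h.2⟩ := by
      have hnm : n ≤ m := hn.trans hm
      rw [← Finset.sum_subset (Finset.subset_univ (Finset.univ.map (Fin.castLEEmb hnm)))]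
      · rw [Finset.sum_map]
        refine Finset.sum_congr rfl fun i _ => ?_
        rw [(hT j _).1, (hT j _).2, (hT j' _).2]
        simp [h.1, h.2]
      · intro i _ hi
        have : ¬ (i : ℕ) < n := fun hi' => hi (by
          simp only [Finset.mem_map, Finset.mem_univ, true_and]
          exact ⟨⟨i, hi'⟩, rfl⟩)
        rw [(hT j i).2]
        simp [this]
    rw [hsum]
    obtain ⟨u, hu⟩ : ∃ u : Fin n, u = ⟨j, h.1⟩ := ⟨_, rfl⟩
    obtain ⟨v, hv⟩ : ∃ v : Fin n, v = ⟨j', h.2⟩ := ⟨_, rfl⟩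
    rw [← hu, ← hv]
    have hsingle := φ.sum_repr (EuclideanSpace.single v (1 : ℝ))
    have hrepr : ∀ i, φ.repr (EuclideanSpace.single v (1 : ℝ)) i = φ i v := by
      intro i
      rw [φ.repr_apply_apply, EuclideanSpace.inner_single_right]
      simp
    simp only [hrepr] at hsingle
    have hsv : ∀ w, ∑ i, φ i v * φ i w = if w = v then 1 else 0 := by
      intro w
      have := congrArg (fun X : EuclideanSpace ℝ (Fin n) => X w) hsingle
      simpa [Pi.single_apply] using this
    have hL : ∀ i, lam i * φ i u = ∑ w, G.lapMatrix ℝ u w * φ i w := fun i =>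
      (congrFun (hφ i) u).symm
    calc ∑ i, (lam i + 1) * φ i u * φ i v
        = ∑ i, (∑ w, G.lapMatrix ℝ u w * φ i w) * φ i v + ∑ i, φ i v * φ i u := by
          rw [← Finset.sum_add_distrib]
          refine Finset.sum_congr rfl fun i _ => ?_
          rw [← hL]; ring
      _ = ∑ w, G.lapMatrix ℝ u w * ∑ i, φ i v * φ i w + ∑ i, φ i v * φ i u := by
          congr 1
          simp only [Finset.sum_mul, Finset.mul_sum]
          rw [Finset.sum_comm]
          refine Finset.sum_congr rfl fun w _ => Finset.sum_congr rfl fun i _ => by ring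
      _ = (G.lapMatrix ℝ + 1) u v := by
          simp [hsv, Matrix.one_apply]
  · refine Finset.sum_eq_zero fun i _ => ?_
    rw [(hT j i).2, (hT j' i).2]
    by_cases h1 : (j : ℕ) < n
    · have h2 : ¬ (j' : ℕ) < n := fun h2 => h ⟨h1, h2⟩
      simp [h2]
    · simp [h1]

/-! ### The node-LPE Transformer -/

theorem nonempty_hidden_index {N k m : ℕ} (M : LPEInput N m →ₗ[ℝ] LPEHidden N k m)
    (hN : 1 ≤ N) (hm : N ≤ m) (hM : Function.Injective M) : Nonempty (Fin N × Fin k) := by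
  by_contra hk
  rw [not_nonempty_iff] at hk
  let q : (Fin N × Fin 2) × Fin m := ((⟨0, hN⟩, 0), ⟨0, hN.trans hm⟩)
  have h1 := hM (Subsingleton.elim (M 0) (M (EuclideanSpace.single q 1)))
  have h2 := congrArg (fun X : LPEInput N m => X q) h1
  simp at h2

theorem exists_lpe_separating {N k m : ℕ} (M : LPEInput N m →ₗ[ℝ] LPEHidden N k m)
    (hN : 1 ≤ N) (hm : N ≤ m) (hM : Function.Injective M) :
    ∃ f : LPEHidden N k m → LPEHidden N k m, Continuous f ∧
      (∃ c₀ : Fin k, ∀ X j c i, c ≠ c₀ → f X ((j, c), i) = 0) ∧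
      SeparatesIsoClasses N (fun _ G => lapReps N m G) (fun T => f (M T)) ∧
      SeparatesIsoClasses N (fun _ G => lapReps N m G) (fun T => sumPool (f (M T))) := by
  classical
  obtain ⟨code, hcode⟩ := exists_isoCode
  obtain ⟨h, hh, hc⟩ := exists_continuous_code N (lapInput N) (fun G => (code G : ℝ))
    (fun G H hG hH hGH => by
      exact_mod_cast (hcode G H).2 (nonempty_iso_of_lapInput hG hH hGH))
  -- A linear left inverse recovers the tensor from its image, so the invariant extends continuously
  -- to the whole hidden space.
  obtain ⟨M', hM'⟩ := M.exists_leftInverse_of_injective (LinearMap.ker_eq_bot.2 hM)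
  have hM'M : ∀ T, M' (M T) = T := fun T => LinearMap.congr_fun hM' T
  let j₀ : Fin N := ⟨0, hN⟩
  let i₀ : Fin m := ⟨0, hN.trans hm⟩
  obtain ⟨-, c₀⟩ := nonempty_hidden_index M hN hm hM
  let s : LPEHidden N k m → ℝ := fun X =>
    h fun q => ∑ i, (M' X ((q.1, 0), i) + 1) * M' X ((q.1, 1), i) * M' X ((q.2, 1), i)
  have hs : Continuous s := by
    have hM'c : Continuous M' := M'.continuous_of_finiteDimensional
    refine hh.comp (continuous_pi fun q => ?_)
    fun_prop
  have hsT : ∀ {n : ℕ} (G : SimpleGraph (Fin n)), n ≤ N → ∀ T ∈ lapReps N m G,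
      s (M T) = code ⟨n, G⟩ := by
    intro n G hn T hT
    simp only [s, hM'M]
    rw [lapInput_eq_of_mem_lapReps hn hm hT]
    exact hc ⟨n, G⟩ hn
  let f : LPEHidden N k m → LPEHidden N k m := fun X => s X • EuclideanSpace.single ((j₀, c₀), i₀) 1
  have hf : ∀ X q, f X q = if q = ((j₀, c₀), i₀) then s X else 0 := by
    intro X q
    simp [f]
  have hpool : ∀ X, sumPool (f X) (j₀, c₀) = s X := by
    intro X
    change ∑ i, f X ((j₀, c₀), i) = s X
    simp [hf]
  refine ⟨f, hs.smul continuous_const, ⟨c₀, fun X j c i hne => ?_⟩, ?_, ?_⟩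
  · rw [hf, if_neg]
    intro h
    simp only [Prod.mk.injEq] at h
    exact hne h.1.2
  · intro n₁ n₂ G₁ G₂ h₁ h₂ T₁ hT₁ T₂ hT₂
    rw [← hcode ⟨n₁, G₁⟩ ⟨n₂, G₂⟩, ← Nat.cast_inj (R := ℝ), ← hsT G₁ h₁ T₁ hT₁,
      ← hsT G₂ h₂ T₂ hT₂]
    constructor
    · intro h
      have := congrArg (fun X : LPEHidden N k m => X ((j₀, c₀), i₀)) h
      simpa [hf] using this
    · intro h
      simp only [f, h]
  · intro n₁ n₂ G₁ G₂ h₁ h₂ T₁ hT₁ T₂ hT₂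
    rw [← hcode ⟨n₁, G₁⟩ ⟨n₂, G₂⟩, ← Nat.cast_inj (R := ℝ), ← hsT G₁ h₁ T₁ hT₁,
      ← hsT G₂ h₂ T₂ hT₂]
    constructor
    · intro h
      rw [← hpool (M T₁), ← hpool (M T₂)]
      simp only [h]
    · intro h
      simp only [f, h]

theorem sumPool_sub {N k m : ℕ} (X Y : LPEHidden N k m) :
    sumPool (X - Y) = sumPool X - sumPool Y := by
  ext q
  simp [sumPool, Finset.sum_sub_distrib]

theorem norm_sumPool_le {N k m : ℕ} (X : LPEHidden N k m) :
    ‖sumPool X‖ ≤ (Fintype.card (Fin N × Fin k) * m : ℝ) * ‖X‖ := by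
  rw [mul_assoc]
  refine euclidean_norm_le (by positivity) fun q => ?_
  change |∑ i, X (q, i)| ≤ _
  refine (Finset.abs_sum_le_sum_abs _ _).trans ?_
  calc ∑ i : Fin m, |X (q, i)| ≤ ∑ _i : Fin m, ‖X‖ := Finset.sum_le_sum fun i _ => by
        simpa using PiLp.norm_apply_le X (q, i)
    _ = m * ‖X‖ := by simp

-- The range of `M` may be a null set, so the estimate on the ball alone says nothing about inputs
-- `M T`. Hence the pushforward of Lebesgue measure on the preimage of the ball enters as an
-- additional measure. Sum pooling costs only the constant factor `D`.
open MeasureTheory in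
theorem exists_lpe_approx {N k m : ℕ} (M : LPEInput N m →ₗ[ℝ] LPEHidden N k m) {R : ℝ}
    (hR : 0 ≤ R) (hk : Nonempty (Fin N × Fin k)) (hM : Function.Injective M)
    (f : LPEHidden N k m → LPEHidden N k m) (hf : ContinuousOn f (Metric.closedBall 0 R))
    {p : ℝ≥0∞} {ε : ℝ} (hp : 1 ≤ p) (hp' : p ≠ ∞) (hε : 0 < ε) (P : Finset (LPEInput N m))
    (hP : ∀ T ∈ P, M T ∈ Metric.closedBall (0 : LPEHidden N k m) R) :
    ∃ (t : Transformer (Fin N × Fin k)) (E : LPEHidden N k m),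
      eLpNorm (fun X => f X - t.applyPE E X) p
        (volume.restrict (Metric.closedBall 0 R)) < ENNReal.ofReal ε ∧
      eLpNorm (fun T => sumPool (f (M T)) - lpeTransformer M t E T) p
        (volume.restrict {T | M T ∈ Metric.closedBall 0 R}) < ENNReal.ofReal ε ∧
      ∀ T ∈ P, dist (sumPool (f (M T))) (lpeTransformer M t E T) < ε := by
  classical
  have hMc : Continuous M := M.continuous_of_finiteDimensional
  set B : Set (LPEHidden N k m) := Metric.closedBall 0 R with hB
  set ν : Measure (LPEInput N m) := volume.restrict {T | M T ∈ B} with hν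
  have hMB : IsClosed {T | M T ∈ B} := Metric.isClosed_closedBall.preimage hMc
  have hbdd : Bornology.IsBounded {T | M T ∈ B} := by
    obtain ⟨K, -, hK⟩ := M.exists_antilipschitzWith (LinearMap.ker_eq_bot.2 hM)
    exact hK.isBounded_preimage Metric.isBounded_closedBall
  have hνfin : IsFiniteMeasure ν := ⟨by simpa [hν] using hbdd.measure_lt_top⟩
  have hνB : ∀ᵐ T ∂ν, M T ∈ B := ae_restrict_mem hMB.measurableSet
  obtain ⟨C, hC⟩ := exists_transformerPE_approx hR hf
  set D : ℝ := (Fintype.card (Fin N × Fin k) : ℝ) * m with hD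
  have hD0 : 0 ≤ D := by positivity
  have hpool : ∀ (t : Transformer (Fin N × Fin k)) (E : LPEHidden N k m) (T : LPEInput N m),
      ‖sumPool (f (M T)) - lpeTransformer M t E T‖ ≤ D * ‖f (M T) - t.applyPE E (M T)‖ := by
    intro t E T
    rw [lpeTransformer, ← sumPool_sub]
    exact norm_sumPool_le _
  obtain ⟨δ, hδ, hLp⟩ := exists_pos_eLpNorm_lt (E := LPEOutput N k) ν (D * C) hp hp' hε
  obtain ⟨ε', hε', h1, h2, h3, h4⟩ : ∃ ε' > 0, ε' ≤ ε ∧ ε' ≤ δ ∧ D * ε' < ε ∧ D * ε' < δ := by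
    refine ⟨min ε δ / (D + 1), by positivity, ?_, ?_, ?_, ?_⟩
    all_goals
      have h1 := min_le_left ε δ
      have h2 := min_le_right ε δ
      have h0 : 0 < min ε δ := lt_min hε hδ
      set z := min ε δ
    · rw [div_le_iff₀ (by positivity)]; nlinarith
    · rw [div_le_iff₀ (by positivity)]; nlinarith
    · rw [mul_div_assoc', div_lt_iff₀ (by positivity)]; nlinarith
    · rw [mul_div_assoc', div_lt_iff₀ (by positivity)]; nlinarith
  obtain ⟨t, E, htC, htLp, htP, htν⟩ := hC p hp hp' ε' hε' (P.image M) (by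
      intro X hX
      obtain ⟨T, hT, rfl⟩ := Finset.mem_image.1 hX
      exact hP T hT) (ν.map M) inferInstance (by
      exact (ae_map_iff hMc.measurable.aemeasurable
        Metric.isClosed_closedBall.measurableSet).2 hνB)
  refine ⟨t, E, htLp.trans_le (ENNReal.ofReal_le_ofReal h1), hLp _ ?_ ?_, fun T hT => ?_⟩
  · filter_upwards [hνB] with T hT
    exact (hpool t E T).trans (mul_le_mul_of_nonneg_left (htC _ hT) hD0)
  · refine le_trans (measure_mono_ae (t := M ⁻¹' {X | X ∈ B ∧ ε' ≤ ‖f X - t.applyPE E X‖}) ?_)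
      ((Measure.le_map_apply hMc.measurable.aemeasurable _).trans
        (htν.trans (ENNReal.ofReal_le_ofReal h2)))
    filter_upwards [hνB] with T hT h
    refine ⟨hT, ?_⟩
    by_contra hlt
    have h5 : δ ≤ D * ‖f (M T) - t.applyPE E (M T)‖ := le_trans h (hpool t E T)
    nlinarith [mul_le_mul_of_nonneg_left (not_le.1 hlt).le hD0]
  · rw [dist_eq_norm]
    have h5 := htP _ (Finset.mem_image_of_mem M hT)
    exact (hpool t E T).trans_lt
      ((mul_le_mul_of_nonneg_left h5.le hD0).trans_lt h3)

/-! ### The naive node Transformer -/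

theorem exists_node_separating (N : ℕ) :
    ∃ f : SeqSpace (Fin N) (Fin N) → SeqSpace (Fin N) (Fin N), Continuous f ∧
      SeparatesIsoClasses N (fun _ G => {nodeInput N G}) f := by
  classical
  obtain ⟨code, hcode⟩ := exists_isoCode
  obtain ⟨h, hh, hc⟩ := exists_continuous_code N (fun G => nodeInput N G.2) (fun G => (code G : ℝ))
    (fun G H hG hH hGH => by
      exact_mod_cast (hcode G H).2 (nonempty_iso_of_nodeInput hG hH hGH))
  rcases Nat.eq_zero_or_pos N with rfl | hN
  · refine ⟨id, continuous_id, ?_⟩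
    intro n₁ n₂ G₁ G₂ h₁ h₂ x₁ _ x₂ _
    obtain rfl : n₁ = 0 := by omega
    obtain rfl : n₂ = 0 := by omega
    rw [Subsingleton.elim G₁ G₂]
    exact ⟨fun _ => ⟨SimpleGraph.Iso.refl⟩, fun _ => Subsingleton.elim _ _⟩
  · let i₀ : Fin N := ⟨0, hN⟩
    refine ⟨fun X => h X • EuclideanSpace.single (i₀, i₀) 1, hh.smul continuous_const, ?_⟩
    rintro n₁ n₂ G₁ G₂ h₁ h₂ _ rfl _ rfl
    simp only
    rw [hc ⟨n₁, G₁⟩ h₁, hc ⟨n₂, G₂⟩ h₂, ← hcode ⟨n₁, G₁⟩ ⟨n₂, G₂⟩, ← Nat.cast_inj (R := ℝ)]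
    constructor
    · intro h
      have := congrArg (fun X : SeqSpace (Fin N) (Fin N) => X (i₀, i₀)) h
      simpa using this
    · intro h
      rw [h]

open MeasureTheory in
theorem exists_node_approx {N : ℕ} {R : ℝ}
    (hR : ∀ (n : ℕ) (G : SimpleGraph (Fin n)), n ≤ N →
      nodeInput N G ∈ Metric.closedBall (0 : SeqSpace (Fin N) (Fin N)) R)
    (f : SeqSpace (Fin N) (Fin N) → SeqSpace (Fin N) (Fin N))
    (hf : ContinuousOn f (Metric.closedBall 0 R)) {p : ℝ≥0∞} {ε : ℝ} (hp : 1 ≤ p) (hp' : p ≠ ∞)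
    (hε : 0 < ε) :
    ∃ (t : Transformer (Fin N)) (E : SeqSpace (Fin N) (Fin N)),
      eLpNorm (fun X => f X - t.applyPE E X) p
        (volume.restrict (Metric.closedBall 0 R)) < ENNReal.ofReal ε ∧
      ∀ (n : ℕ) (G : SimpleGraph (Fin n)), n ≤ N →
        dist (f (nodeInput N G)) (t.applyPE E (nodeInput N G)) < ε := by
  classical
  rcases Nat.eq_zero_or_pos N with rfl | hN
  · refine ⟨[], 0, ?_, fun n G _ => ?_⟩
    · have : (fun X : SeqSpace (Fin 0) (Fin 0) => f X - Transformer.applyPE [] 0 X) = 0 :=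
        Subsingleton.elim _ _
      rw [this, eLpNorm_zero]
      exact ENNReal.ofReal_pos.2 hε
    · rw [Subsingleton.elim (f _) (Transformer.applyPE [] 0 _), dist_self]
      exact hε
  · have hR0 : 0 ≤ R := (norm_nonneg _).trans (mem_closedBall_zero_iff.1 (hR 0 ⊥ (Nat.zero_le _)))
    have : Nonempty (Fin N) := ⟨⟨0, hN⟩⟩
    obtain ⟨C, hC⟩ := exists_transformerPE_approx hR0 hf
    obtain ⟨t, E, -, h1, h2, -⟩ := hC p hp hp' ε hε
      ((finite_graphs N).toFinset.image fun G => nodeInput N G.2) (by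
        intro X hX
        obtain ⟨G, hG, rfl⟩ := Finset.mem_image.1 hX
        exact hR G.1 G.2 ((finite_graphs N).mem_toFinset.1 hG)) 0 inferInstance (by simp)
    refine ⟨t, E, h1, fun n G hn => ?_⟩
    rw [dist_eq_norm]
    exact h2 _ (Finset.mem_image.2 ⟨⟨n, G⟩, (finite_graphs N).mem_toFinset.2 hn, rfl⟩)

/-! ### The naive edge Transformer -/

theorem edgeInput_injective_columns {N : ℕ} {code : NodePair N → ℝ}
    (hcode : Function.Injective code) (G : SimpleGraph (Fin N)) :
    Function.Injective (edgeInput code G).toMat.transpose := by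
  intro e e' h
  have h0 : edgeInput code G (0, e) = edgeInput code G (0, e') := congrFun h 0
  exact hcode (by simpa [edgeInput] using h0)

/-- The injective labels in the first row force the two permutations to be equal, and the second row
then compares the adjacencies. -/
theorem eq_of_permCols_edgeInput {N : ℕ} {code : NodePair N → ℝ}
    (hcode : Function.Injective code) {G H : SimpleGraph (Fin N)} {σ τ : Equiv.Perm (NodePair N)}
    (h : permCols σ (edgeInput code G) = permCols τ (edgeInput code H)) : G = H := by
  have hq : ∀ a e, edgeInput code G (a, σ e) = edgeInput code H (a, τ e) := fun a e =>
    congrArg (fun X : SeqSpace (Fin 2) (NodePair N) => X (a, e)) h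
  have hστ : ∀ e, σ e = τ e := fun e => hcode (by simpa [edgeInput] using hq 0 e)
  have hadj : ∀ e : NodePair N, G.Adj e.1.1 e.1.2 ↔ H.Adj e.1.1 e.1.2 := by
    intro e
    have h1 := hq 1 (σ.symm e)
    rw [← hστ, Equiv.apply_symm_apply] at h1
    simp only [edgeInput, one_ne_zero, if_false] at h1
    by_cases hG : G.Adj e.1.1 e.1.2 <;> by_cases hH : H.Adj e.1.1 e.1.2 <;> simp_all
  ext u v
  rcases lt_trichotomy u v with huv | huv | huv
  · exact hadj ⟨(u, v), huv⟩
  · simp [huv]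
  · rw [G.adj_comm, H.adj_comm]
    exact hadj ⟨(v, u), huv⟩

theorem continuous_permCols {α β : Type} [Fintype α] [Fintype β] (σ : Equiv.Perm β) :
    Continuous (permCols σ : SeqSpace α β → SeqSpace α β) := by
  refine (PiLp.continuous_toLp 2 _).comp (continuous_pi fun q => ?_)
  fun_prop

theorem exists_edge_separating {N : ℕ} {code : NodePair N → ℝ} (hcode : Function.Injective code) :
    ∃ f : SeqSpace (Fin 2) (NodePair N) → SeqSpace (Fin 2) (NodePair N), Continuous f ∧
      (∀ (σ : Equiv.Perm (NodePair N)) (X), f (permCols σ X) = permCols σ (f X)) ∧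
      ∀ G₁ G₂ : SimpleGraph (Fin N),
        f (edgeInput code G₁) = f (edgeInput code G₂) ↔ Nonempty (G₁ ≃g G₂) := by
  classical
  obtain ⟨iso, hiso⟩ := exists_isoCode
  let Z : Set (SeqSpace (Fin 2) (NodePair N)) :=
    Set.range fun p : Equiv.Perm (NodePair N) × SimpleGraph (Fin N) =>
      permCols p.1 (edgeInput code p.2)
  let c : SeqSpace (Fin 2) (NodePair N) → ℝ := fun X =>
    if hX : ∃ p : Equiv.Perm (NodePair N) × SimpleGraph (Fin N),
      permCols p.1 (edgeInput code p.2) = X then iso ⟨N, hX.choose.2⟩ else 0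
  have hc : ∀ σ G, c (permCols σ (edgeInput code G)) = iso ⟨N, G⟩ := by
    intro σ G
    have hX : ∃ p : Equiv.Perm (NodePair N) × SimpleGraph (Fin N),
      permCols p.1 (edgeInput code p.2) = permCols σ (edgeInput code G) := ⟨(σ, G), rfl⟩
    simp only [c, dif_pos hX]
    rw [eq_of_permCols_edgeInput hcode hX.choose_spec]
  obtain ⟨h, hh, hhc⟩ := exists_continuous_interp (Set.finite_range _ : Z.Finite) c
  -- Summing over all permutations gives exact invariance. On permuted graph inputs `h` is already
  -- invariant, so there the sum only multiplies the code by the number of permutations.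
  let s : SeqSpace (Fin 2) (NodePair N) → ℝ := fun X =>
    ∑ σ : Equiv.Perm (NodePair N), h (permCols σ X)
  have hs : Continuous s :=
    continuous_finsetSum _ fun σ _ => hh.comp (continuous_permCols σ)
  have hsσ : ∀ τ X, s (permCols τ X) = s X := by
    intro τ X
    have : ∀ σ, permCols σ (permCols τ X) = permCols (τ * σ) X := fun σ => rfl
    simp only [s, this]
    exact Equiv.sum_comp (Equiv.mulLeft τ) fun σ => h (permCols σ X)
  have hsG : ∀ G, s (edgeInput code G) = Fintype.card (Equiv.Perm (NodePair N)) * iso ⟨N, G⟩ := by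
    intro G
    simp only [s]
    rw [Finset.sum_congr rfl fun σ _ => (hhc _ ⟨(σ, G), rfl⟩).trans (hc σ G)]
    simp
  have hcard : (Fintype.card (Equiv.Perm (NodePair N)) : ℝ) ≠ 0 :=
    Nat.cast_ne_zero.2 Fintype.card_ne_zero
  refine ⟨fun X => WithLp.toLp 2 fun _ => s X,
    (PiLp.continuous_toLp 2 _).comp (continuous_pi fun _ => hs), fun σ X => ?_, fun G₁ G₂ => ?_⟩
  · simp only [hsσ]
    rfl
  · rw [← hiso ⟨N, G₁⟩ ⟨N, G₂⟩]
    constructor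
    · intro h
      by_cases hne : Nonempty (NodePair N)
      · obtain ⟨e⟩ := hne
        have h1 : s (edgeInput code G₁) = s (edgeInput code G₂) :=
          congrArg (fun X : SeqSpace (Fin 2) (NodePair N) => X (0, e)) h
        rw [hsG, hsG] at h1
        exact_mod_cast mul_left_cancel₀ hcard h1
      -- Without pairs of nodes all inputs are the same empty array, so the two graphs are equal.
      · have : G₁ = G₂ := eq_of_permCols_edgeInput hcode (σ := 1) (τ := 1) (by
          rw [not_nonempty_iff] at hne
          exact Subsingleton.elim _ _)
        rw [this]
    · intro h
      simp only
      rw [hsG, hsG, h]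

open MeasureTheory in
theorem exists_edge_approx {N : ℕ} {code : NodePair N → ℝ} (hcode : Function.Injective code)
    {R : ℝ} (hR : ∀ G : SimpleGraph (Fin N),
      edgeInput code G ∈ Metric.closedBall (0 : SeqSpace (Fin 2) (NodePair N)) R)
    (f : SeqSpace (Fin 2) (NodePair N) → SeqSpace (Fin 2) (NodePair N))
    (hf : ContinuousOn f (Metric.closedBall 0 R))
    (hσ : ∀ (σ : Equiv.Perm (NodePair N)) (X), X ∈ Metric.closedBall 0 R →
      f (permCols σ X) = permCols σ (f X)) {p : ℝ≥0∞} {ε : ℝ} (hp : 1 ≤ p) (hp' : p ≠ ∞)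
    (hε : 0 < ε) :
    ∃ t : Transformer (Fin 2),
      eLpNorm (fun X => f X - t.apply X) p
        (volume.restrict (Metric.closedBall 0 R)) < ENNReal.ofReal ε ∧
      ∀ G : SimpleGraph (Fin N),
        dist (f (edgeInput code G)) (t.apply (edgeInput code G)) < ε := by
  classical
  have hR0 : 0 ≤ R := (norm_nonneg _).trans (mem_closedBall_zero_iff.1 (hR ⊥))
  obtain ⟨t, h1, h2⟩ := exists_transformer_equivariant_approx hR0 hf hσ hp hp' hε
    (Finset.univ.image fun G : SimpleGraph (Fin N) => edgeInput code G) (by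
      intro X hX
      obtain ⟨G, -, rfl⟩ := Finset.mem_image.1 hX
      exact ⟨hR G, edgeInput_injective_columns hcode G⟩)
  refine ⟨t, h1, fun G => ?_⟩
  rw [dist_eq_norm]
  exact h2 _ (Finset.mem_image_of_mem _ (Finset.mem_univ G))

/-! ### A Transformer that tells apart all non-isomorphic graphs -/

-- Eigenvector entries are at most 1 in absolute value, and an eigenvalue is the Rayleigh quotient
-- of its unit eigenvector.
open Classical in
theorem abs_le_of_mem_lapReps {N m n : ℕ} {G : SimpleGraph (Fin n)} {T : LPEInput N m}
    (hT : T ∈ lapReps N m G) (q : (Fin N × Fin 2) × Fin m) :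
    |T q| ≤ 1 + ∑ u, ∑ v, |G.lapMatrix ℝ u v| := by
  obtain ⟨lam, φ, -, hφ, hT⟩ := hT
  set S := ∑ u, ∑ v, |G.lapMatrix ℝ u v| with hS
  have hS0 : 0 ≤ S := Finset.sum_nonneg fun _ _ => Finset.sum_nonneg fun _ _ => abs_nonneg _
  have hφ1 : ∀ i v, |φ i v| ≤ 1 := fun i v => by
    have := PiLp.norm_apply_le (φ i) v
    rwa [φ.orthonormal.1 i, Real.norm_eq_abs] at this
  have hlam : ∀ i, |lam i| ≤ S := by
    intro i
    have h1 : ∑ v, φ i v * φ i v = 1 := by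
      have := EuclideanSpace.norm_sq_eq (φ i)
      rw [φ.orthonormal.1 i] at this
      simp only [Real.norm_eq_abs, sq_abs, one_pow] at this
      rw [this]
      exact Finset.sum_congr rfl fun v _ => (sq _).symm
    have h2 : lam i = ∑ u, φ i u * ∑ v, G.lapMatrix ℝ u v * φ i v := by
      have h3 : ∀ u, ∑ v, G.lapMatrix ℝ u v * φ i v = lam i * φ i u := fun u =>
        congrFun (hφ i) u
      simp only [h3]
      have h4 : lam i = ∑ u, lam i * (φ i u * φ i u) := by
        rw [← Finset.mul_sum, h1, mul_one]
      exact h4.trans (Finset.sum_congr rfl fun u _ => by ring)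
    rw [h2]
    refine (Finset.abs_sum_le_sum_abs _ _).trans (Finset.sum_le_sum fun u _ => ?_)
    rw [abs_mul]
    refine (mul_le_of_le_one_left (abs_nonneg _) (hφ1 i u)).trans ?_
    refine (Finset.abs_sum_le_sum_abs _ _).trans (Finset.sum_le_sum fun v _ => ?_)
    rw [abs_mul]
    exact mul_le_of_le_one_right (abs_nonneg _) (hφ1 i v)
  obtain ⟨⟨j, c⟩, i⟩ := q
  fin_cases c
  · simp only [Fin.zero_eta, Fin.isValue, (hT j i).1]
    split_ifs
    · linarith [hlam ⟨i, (by assumption : _ ∧ _).2⟩]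
    · simp only [abs_zero]; linarith
  · simp only [Fin.mk_one, Fin.isValue, (hT j i).2]
    split_ifs with h
    · linarith [hφ1 ⟨i, h.2⟩ ⟨j, h.1⟩]
    · simp only [abs_zero]; linarith

theorem exists_bound_lapReps (N m : ℕ) : ∃ Λ : ℝ, 0 ≤ Λ ∧ ∀ (n : ℕ) (G : SimpleGraph (Fin n)),
    n ≤ N → ∀ T ∈ lapReps N m G, ∀ q, |T q| ≤ Λ := by
  classical
  obtain ⟨Λ, hΛ⟩ := ((finite_graphs N).image fun G =>
    1 + ∑ u, ∑ v, |G.2.lapMatrix ℝ u v|).bddAbove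
  exact ⟨max Λ 0, le_max_right _ _, fun n G hn T hT q =>
    (abs_le_of_mem_lapReps hT q).trans (le_max_of_le_left (hΛ ⟨⟨n, G⟩, hn, by congr!⟩))⟩

/-- ReLU networks approximate products of three coordinates, by polarization. -/
theorem exists_reluSpan_product {α : Type} [Fintype α] (a b c : α) (Λ : ℝ) {ε : ℝ}
    (hε : 0 < ε) : ∃ s ∈ reluSpan α, ∀ x : α → ℝ, (∀ q, |x q| ≤ Λ) →
      |s x - (x a + 1) * x b * x c| ≤ ε := by
  classical
  -- With the factors xₐ + 1, x_b and x_c, all four linear forms cubed below are bounded by 3Λ + 1.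
  obtain ⟨T, hT, hTc⟩ := exists_reluLine_approx (fun x => x ^ 3) (by fun_prop) (3 * Λ + 1) hε
  let e : α → α → ℝ := fun q => Pi.single q 1
  have he : ∀ q (x : α → ℝ), e q ⬝ᵥ x = x q := fun q x => by simp [e]
  refine ⟨(1 / 24 : ℝ) • ((fun x : α → ℝ => T ((e a + e b + e c) ⬝ᵥ x + 1)) -
    (fun x : α → ℝ => T ((e a + e b - e c) ⬝ᵥ x + 1)) -
    (fun x : α → ℝ => T ((e a - e b + e c) ⬝ᵥ x + 1)) -
    (fun x : α → ℝ => T ((-e a + e b + e c) ⬝ᵥ x + (-1)))), ?_, fun x hx => ?_⟩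
  · exact Submodule.smul_mem _ _ (Submodule.sub_mem _ (Submodule.sub_mem _ (Submodule.sub_mem _
      (reluLine.comp_affine hT _ _) (reluLine.comp_affine hT _ _)) (reluLine.comp_affine hT _ _))
      (reluLine.comp_affine hT _ _))
  · simp only [Pi.smul_apply, Pi.sub_apply, smul_eq_mul, add_dotProduct, sub_dotProduct,
      neg_dotProduct, he]
    have ha := abs_le.1 (hx a)
    have hb := abs_le.1 (hx b)
    have hc := abs_le.1 (hx c)
    have h1 := abs_le.1 (hTc (x a + x b + x c + 1)
      (abs_le.2 ⟨by linarith, by linarith⟩))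
    have h2 := abs_le.1 (hTc (x a + x b - x c + 1) (abs_le.2 ⟨by linarith, by linarith⟩))
    have h3 := abs_le.1 (hTc (x a - x b + x c + 1) (abs_le.2 ⟨by linarith, by linarith⟩))
    have h4 := abs_le.1 (hTc (-x a + x b + x c + (-1)) (abs_le.2 ⟨by linarith, by linarith⟩))
    have hpol : (x a + 1) * x b * x c = 1 / 24 * ((x a + x b + x c + 1) ^ 3 -
        (x a + x b - x c + 1) ^ 3 - (x a - x b + x c + 1) ^ 3 -
        (-x a + x b + x c + (-1)) ^ 3) := by ring
    rw [hpol, abs_le]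
    constructor <;> linarith

/-- A token contains one eigenpair at all nodes, hence all the factors of its term of the spectral
sum; `w` pairs this term with a linear functional. -/
theorem exists_reluSpan_gram {N : ℕ} (w : Fin N × Fin N → ℝ) (Λ : ℝ) {ε : ℝ} (hε : 0 < ε) :
    ∃ s ∈ reluSpan (Fin N × Fin 2), ∀ x : Fin N × Fin 2 → ℝ, (∀ q, |x q| ≤ Λ) →
      |s x - ∑ q, w q * ((x (q.1, 0) + 1) * x (q.1, 1) * x (q.2, 1))| ≤ ε := by
  set D : ℝ := ∑ q, |w q| with hD
  have hD0 : 0 ≤ D := Finset.sum_nonneg fun _ _ => abs_nonneg _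
  choose s hs hsx using fun q : Fin N × Fin N => exists_reluSpan_product
    (q.1, (0 : Fin 2)) (q.1, 1) (q.2, 1) Λ (ε := ε / (D + 1)) (by positivity)
  refine ⟨fun x => ∑ q, w q * s q x,
    reluSpan.sum_mem _ fun q _ => Submodule.smul_mem _ (w q) (hs q), fun x hx => ?_⟩
  rw [← Finset.sum_sub_distrib]
  refine (Finset.abs_sum_le_sum_abs _ _).trans ?_
  calc ∑ q, |w q * s q x - w q * ((x (q.1, 0) + 1) * x (q.1, 1) * x (q.2, 1))|
      ≤ ∑ q, |w q| * (ε / (D + 1)) := Finset.sum_le_sum fun q _ => by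
        rw [← mul_sub, abs_mul]
        exact mul_le_mul_of_nonneg_left (hsx q x hx) (abs_nonneg _)
    _ = D * ε / (D + 1) := by rw [← Finset.sum_mul, mul_div_assoc]
    _ ≤ ε := by rw [div_le_iff₀ (by positivity)]; nlinarith

/-- An attention head with constant weights that sums the coordinate `a` over the sequence and
writes the result into the coordinate `b`. -/
theorem sum_head_apply {α : Type} [Fintype α] [DecidableEq α] {m : ℕ} (hm : 0 < m) (a b : α)
    (X : Matrix α (Fin m) ℝ) :
    AttentionHead.apply (s := 1)
      ⟨0, 0, Matrix.of fun _ => Pi.single a 1, Matrix.of fun i _ => if i = b then (m : ℝ) else 0⟩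
      X = Matrix.of fun i _ => if i = b then ∑ l, X a l else 0 := by
  have hm' : (m : ℝ) ≠ 0 := by positivity
  ext i l
  simp [AttentionHead.apply, colSoftmax, Matrix.mul_apply, Pi.single_apply]
  refine if_congr Iff.rfl ?_ rfl
  rw [← Finset.sum_mul]
  field_simp

theorem lpeLinear_one {N m : ℕ} (T : LPEInput N m) :
    lpeLinear N m (1 : Matrix (Fin 2) (Fin 2) ℝ) T = T := by
  ext q
  simp [lpeLinear, Matrix.one_apply]

/-- A node-LPE Transformer that computes a code of the isomorphism class. -/
theorem exists_lpeTransformer_code {N m : ℕ} (hN : 1 ≤ N) (hm : N ≤ m)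
    (code : (Σ n, SimpleGraph (Fin n)) → ℕ)
    (hcode : ∀ G H, code G = code H ↔ Nonempty (G.2 ≃g H.2)) :
    ∃ (t : Transformer (Fin N × Fin 2)) (q₀ : Fin N × Fin 2), ∀ (n : ℕ) (G : SimpleGraph (Fin n)),
      n ≤ N → ∀ T ∈ lapReps N m G,
        lpeTransformer (lpeLinear N m 1) t 0 T = EuclideanSpace.single q₀ (code ⟨n, G⟩ : ℝ) := by
  classical
  have hm0 : 0 < m := by omega
  have hm' : (m : ℝ) ≠ 0 := by positivity
  obtain ⟨w, hw⟩ := exists_dotProduct_injOn ((finite_graphs N).image (lapInput N))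
  set Z : Set ℝ := (fun G => w ⬝ᵥ lapInput N G) '' {G | G.1 ≤ N} with hZ
  have hZfin : Z.Finite := (finite_graphs N).image _
  obtain ⟨η, hη, hplateau⟩ := exists_reluLine_plateau Z hZfin
  -- Division by `m` anticipates the pooling over `m` identical tokens.
  let val : ℝ → ℝ := fun z =>
    if h : ∃ G : Σ n, SimpleGraph (Fin n), G.1 ≤ N ∧ w ⬝ᵥ lapInput N G = z then
      (code h.choose : ℝ) / m else 0
  have hval : ∀ G : Σ n, SimpleGraph (Fin n), G.1 ≤ N →
      val (w ⬝ᵥ lapInput N G) = (code G : ℝ) / m := by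
    intro G hG
    have h : ∃ G' : Σ n, SimpleGraph (Fin n), G'.1 ≤ N ∧
      w ⬝ᵥ lapInput N G' = w ⬝ᵥ lapInput N G := ⟨G, hG, rfl⟩
    simp only [val, dif_pos h]
    rw [(hcode _ G).2 (nonempty_iso_of_lapInput h.choose_spec.1 hG
      (hw ⟨_, h.choose_spec.1, rfl⟩ ⟨G, hG, rfl⟩ h.choose_spec.2))]
  obtain ⟨C, hC⟩ := (hZfin.image fun z => |val z|).bddAbove
  obtain ⟨S, hS, -, hSv⟩ := hplateau val (max C 0) (le_max_right _ _)
    (fun z hz => le_max_of_le_left (hC ⟨z, hz, rfl⟩))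
  obtain ⟨Λ, hΛ0, hΛ⟩ := exists_bound_lapReps N m
  obtain ⟨s, hs, hsx⟩ := exists_reluSpan_gram w Λ (ε := η / m) (by positivity)
  let j₀ : Fin N := ⟨0, hN⟩
  -- The first block clears every coordinate but (j₀, 0), so the sum that attention writes into (j₀,
  -- 1) is not disturbed by the residual connection. The error η/m per token adds up to at most η,
  -- the width of the plateaus.
  obtain ⟨B₁, hB₁⟩ := exists_block_tokenwise (β := Fin m)
    (fun (x : Fin N × Fin 2 → ℝ) q => if q = (j₀, 0) then s x else 0) (by
      intro q
      by_cases hq : q = (j₀, 0)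
      · simpa only [hq, if_true] using hs
      · simpa only [hq, if_false] using reluSpan.const_mem 0)
  obtain ⟨B₂, hB₂⟩ := exists_block_attention (β := Fin m) (s := 1)
    (⟨0, 0, Matrix.of fun _ => Pi.single (j₀, 0) 1,
      Matrix.of fun q _ => if q = (j₀, 1) then (m : ℝ) else 0⟩ : AttentionHead (Fin N × Fin 2) 1)
  obtain ⟨B₃, hB₃⟩ := exists_block_tokenwise (β := Fin m)
    (fun (x : Fin N × Fin 2 → ℝ) q => if q = (j₀, 0) then S (x (j₀, 1)) else 0) (by
      intro q
      by_cases hq : q = (j₀, 0)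
      · simpa [hq] using reluLine.comp_affine hS (Pi.single (j₀, 1) 1) 0
      · simpa only [hq, if_false] using reluSpan.const_mem 0)
  refine ⟨[B₁, B₂, B₃], (j₀, 0), fun n G hn T hT => ?_⟩
  have hsum : |∑ l, s (fun q => T (q, l)) - w ⬝ᵥ lapInput N ⟨n, G⟩| ≤ η := by
    have h1 : w ⬝ᵥ lapInput N ⟨n, G⟩ = ∑ l, ∑ q, w q *
        ((T ((q.1, 0), l) + 1) * T ((q.1, 1), l) * T ((q.2, 1), l)) := by
      rw [← lapInput_eq_of_mem_lapReps hn hm hT, Finset.sum_comm]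
      simp only [dotProduct, Finset.mul_sum]
    rw [h1, ← Finset.sum_sub_distrib]
    refine (Finset.abs_sum_le_sum_abs _ _).trans ((Finset.sum_le_sum fun l _ =>
      hsx (fun q => T (q, l)) fun q => hΛ n G hn T hT (q, l)).trans ?_)
    simp only [Finset.sum_const, Finset.card_univ, Fintype.card_fin, nsmul_eq_mul]
    rw [mul_div_cancel₀ _ hm']
  have hST : S (∑ l, s (fun q => T (q, l))) = (code ⟨n, G⟩ : ℝ) / m := by
    rw [hSv _ ⟨⟨n, G⟩, hn, rfl⟩ _ hsum]
    exact hval ⟨n, G⟩ hn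
  ext q
  change ∑ l, Transformer.applyMat [B₁, B₂, B₃] (SeqSpace.toMat (lpeLinear N m 1 T + 0)) q l = _
  rw [add_zero, lpeLinear_one]
  simp only [Transformer.applyMat_cons, Transformer.applyMat_nil, hB₁, hB₂, hB₃,
    sum_head_apply hm0, Matrix.of_apply, Matrix.add_apply, if_true]
  have hne : ((j₀, 1) : Fin N × Fin 2) ≠ (j₀, 0) := by simp
  simp only [hne, if_false, zero_add]
  change ∑ l : Fin m, (if q = (j₀, 0) then S (∑ l, s (fun q => T (q, l))) else 0) = _
  rw [hST]
  by_cases hq : q = (j₀, 0)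
  · simp [hq, mul_div_cancel₀, hm']
  · simp [hq]

/-- The outputs are exactly the codes, and distinct natural numbers are at distance at least 1. -/
theorem exists_approxSolvesIso {N m : ℕ} {ε : ℝ} (hN : 1 ≤ N) (hm : N ≤ m) (hε : 0 < ε) :
    ∃ (k : ℕ) (W : Matrix (Fin k) (Fin 2) ℝ) (t : Transformer (Fin N × Fin k))
      (E : LPEHidden N k m), Function.Injective W.mulVec ∧
      ApproxSolvesIso ε (lpeTransformer (lpeLinear N m W) t E) := by
  obtain ⟨code, hcode⟩ := exists_isoCode
  obtain ⟨t, q₀, ht⟩ := exists_lpeTransformer_code hN hm code hcode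
  refine ⟨2, 1, t, 0, fun x y h => by simpa using h, fun n₁ n₂ G₁ G₂ h₁ h₂ =>
    ⟨fun h T₁ hT₁ T₂ hT₂ => ?_, fun h T₁ hT₁ T₂ hT₂ => ?_⟩⟩
  · rw [ht n₁ G₁ h₁ T₁ hT₁, ht n₂ G₂ h₂ T₂ hT₂, (hcode ⟨n₁, G₁⟩ ⟨n₂, G₂⟩).2 h, dist_self]
    exact hε
  · rw [ht n₁ G₁ h₁ T₁ hT₁, ht n₂ G₂ h₂ T₂ hT₂, PiLp.dist_single_same, Nat.dist_cast_real]
    exact Nat.pairwise_one_le_dist fun hc => h ((hcode ⟨n₁, G₁⟩ ⟨n₂, G₂⟩).1 hc)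

/-! ### Invariance of the Weisfeiler-Lehman test under isomorphism -/

theorem atomicType_iso {V W : Type} {G : SimpleGraph V} {H : SimpleGraph W} (e : G ≃g H) {r : ℕ}
    (v : Fin r → V) : atomicType H (e ∘ v) = atomicType G v := by
  funext i j
  simp [atomicType, e.map_adj_iff]

theorem wlColor_iso {V W : Type} [Fintype V] [Fintype W] {G : SimpleGraph V} {H : SimpleGraph W}
    (e : G ≃g H) (r s : ℕ) (v : Fin r → V) : wlColor H r s (e ∘ v) = wlColor G r s v := by
  induction s generalizing v with
  | zero => exact atomicType_iso e v
  | succ s ih =>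
    refine Prod.ext (ih v) ?_
    change Finset.univ.val.map _ = Finset.univ.val.map _
    have hmap : (Finset.univ : Finset W).val = (Finset.univ : Finset V).val.map e := by
      rw [← Finset.map_univ_equiv e.toEquiv]
      rfl
    rw [hmap, Multiset.map_map]
    refine Multiset.map_congr rfl fun x _ => Prod.ext ?_ ?_
    · refine Eq.trans ?_ (atomicType_iso e _)
      exact congrArg (atomicType H) (Fin.comp_snoc e v x).symm
    · funext i
      refine Eq.trans ?_ (ih _)
      exact congrArg (wlColor H r s) (Function.comp_update e v i x).symm

theorem not_wlDistinguishes_of_iso {n₁ n₂ : ℕ} {G₁ : SimpleGraph (Fin n₁)}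
    {G₂ : SimpleGraph (Fin n₂)} (e : G₁ ≃g G₂) (r : ℕ) : ¬ WLDistinguishes r G₁ G₂ := by
  rintro ⟨s, hs⟩
  apply hs
  have hmap : (Finset.univ : Finset (Fin r → Fin n₂)).val =
      (Finset.univ : Finset (Fin r → Fin n₁)).val.map (fun v => e ∘ v) := by
    rw [← Finset.map_univ_equiv (Equiv.arrowCongr (Equiv.refl (Fin r)) e.toEquiv)]
    rfl
  rw [hmap, Multiset.map_map]
  exact Multiset.map_congr rfl fun v _ => (wlColor_iso e r s v).symm

/-! ### Back-and-forth systems -/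

theorem univ_val_map_perm {A B : Type} [Fintype A] (π : Equiv.Perm A) {f g : A → B}
    (h : ∀ a, f a = g (π a)) :
    (Finset.univ.val.map f : Multiset B) = Finset.univ.val.map g := by
  have hmap : (Finset.univ : Finset A).val = (Finset.univ : Finset A).val.map π := by
    conv_lhs => rw [← Finset.map_univ_equiv π]
    rfl
  conv_rhs => rw [hmap, Multiset.map_map]
  exact Multiset.map_congr rfl fun a _ => h a

/-- Tuples related by a back-and-forth system with bijections have the same colour. -/
theorem wlColor_eq_of_backAndForth {V : Type} [Fintype V] {G H : SimpleGraph V} {r : ℕ}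
    (Rel : (Fin r → V) → (Fin r → V) → Prop)
    (hat : ∀ v w, Rel v w → atomicType G v = atomicType H w)
    (hstep : ∀ v w, Rel v w → ∃ π : Equiv.Perm V, ∀ x,
      atomicType G (Fin.snoc v x : Fin (r + 1) → V) =
        atomicType H (Fin.snoc w (π x) : Fin (r + 1) → V) ∧
      ∀ i, Rel (Function.update v i x) (Function.update w i (π x)))
    (s : ℕ) (v w : Fin r → V) (h : Rel v w) : wlColor G r s v = wlColor H r s w := by
  induction s generalizing v w with
  | zero => exact hat v w h
  | succ s ih =>
    refine Prod.ext (ih v w h) ?_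
    obtain ⟨π, hπ⟩ := hstep v w h
    refine univ_val_map_perm π fun x => Prod.ext (hπ x).1 ?_
    funext i
    exact ih _ _ ((hπ x).2 i)

/-! ### Cai-Fürer-Immerman graphs over complete graphs -/

/-- The vertices: a base vertex `u` and an even set of base edges at `u`. -/
abbrev CFIVertex (q : ℕ) : Type :=
  {p : Fin q × (Fin q → ZMod 2) // p.2 p.1 = 0 ∧ ∑ v, p.2 v = 0}

/-- The graph over the complete graph on `q` vertices in which the base edge `{u, v}` is twisted by
`y u v + y v u`. -/
def cfiGraph {q : ℕ} (y : Fin q → Fin q → ZMod 2) : SimpleGraph (CFIVertex q) where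
  Adj a b := a.1.1 ≠ b.1.1 ∧ a.1.2 b.1.1 + b.1.2 a.1.1 = y a.1.1 b.1.1 + y b.1.1 a.1.1
  symm := ⟨fun a b h => ⟨h.1.symm, by rw [add_comm, h.2, add_comm]⟩⟩
  loopless := ⟨fun a h => h.1 rfl⟩

/-- The twist supported on the ordered base pair `(u₀, u₁)`. -/
def twistAt {q : ℕ} (u₀ u₁ : Fin q) (u v : Fin q) : ZMod 2 :=
  if u = u₀ ∧ v = u₁ then 1 else 0

/-- Terms cancel in pairs modulo 2. This is the parity invariant behind both non-isomorphism and the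
location of the defect. -/
theorem sum_symmetric_eq_zero {q : ℕ} (c : Fin q → Fin q → ZMod 2) (hd : ∀ u, c u u = 0)
    (hs : ∀ u v, c u v = c v u) : ∑ u, ∑ v, c u v = 0 := by
  rw [← Fintype.sum_prod_type']
  refine Finset.sum_involution (fun p _ => (p.2, p.1)) (fun p _ => ?_) (fun p _ hp h => hp ?_)
    (fun _ _ => Finset.mem_univ _) (fun _ _ => rfl)
  · rw [hs p.1 p.2]
    exact CharTwo.add_self_eq_zero _
  · have : p.2 = p.1 := congrArg Prod.fst h
    rw [this, hd]

theorem sum_twistAt {q : ℕ} (u₀ u₁ u : Fin q) :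
    ∑ v, twistAt u₀ u₁ u v = if u = u₀ then 1 else 0 := by
  by_cases h : u = u₀ <;> simp [twistAt, h]

/-- The twisted graph is not isomorphic to the untwisted one: only the latter has a clique that
contains a vertex over each base vertex. -/
theorem not_nonempty_cfiGraph_iso {q : ℕ} {u₀ u₁ : Fin q} (hu : u₀ ≠ u₁) :
    ¬ Nonempty (cfiGraph (0 : Fin q → Fin q → ZMod 2) ≃g cfiGraph (twistAt u₀ u₁)) := by
  rintro ⟨e⟩
  let z : Fin q → CFIVertex q := fun u => ⟨(u, 0), by simp⟩
  have hz : ∀ u v, u ≠ v → (cfiGraph (0 : Fin q → Fin q → ZMod 2)).Adj (z u) (z v) :=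
    fun u v huv => ⟨huv, by simp [z]⟩
  -- An isomorphism need not respect base vertices, but adjacent vertices have different ones, so
  -- the image of the clique meets each base vertex exactly once.
  have hb : Function.Injective fun u => (e (z u)).1.1 := by
    intro u v h
    by_contra huv
    exact (e.map_adj_iff.2 (hz u v huv)).1 h
  obtain ⟨s, hs⟩ := (Finite.injective_iff_surjective.1 hb).hasRightInverse
  -- Adjacency in the twisted graph makes this symmetric, so its total is 0. Yet the edge sets at
  -- the vertices are even and the twist contributes 1.
  let c : Fin q → Fin q → ZMod 2 := fun u v => (e (z (s u))).1.2 v + twistAt u₀ u₁ u v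
  have hbase : ∀ u, (e (z (s u))).1.1 = u := hs
  have hrow : ∀ u, ∑ v, (e (z (s u))).1.2 v = 0 := fun u => (e (z (s u))).2.2
  have hdiag : ∀ u, (e (z (s u))).1.2 u = 0 := fun u => by
    have := (e (z (s u))).2.1
    rwa [hbase] at this
  have hc := sum_symmetric_eq_zero c
    (fun u => by
      have : ¬ (u = u₀ ∧ u = u₁) := fun h => hu (h.1.symm.trans h.2)
      simp [c, hdiag, twistAt, this])
    (fun u v => by
      by_cases huv : u = v
      · rw [huv]
      have hsne : s u ≠ s v := fun h => huv (by rw [← hbase u, ← hbase v, h])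
      have h1 := (e.map_adj_iff.2 (hz _ _ hsne)).2
      rw [hbase, hbase] at h1
      simp only [c]
      have h2 : ∀ a b t t' : ZMod 2, a + b = t + t' → a + t = b + t' := by decide
      exact h2 _ _ _ _ h1)
  simp only [c, Finset.sum_add_distrib, hrow, sum_twistAt] at hc
  simp at hc

/-- Shift of a vertex by the row of `y` at its base vertex. -/
def cfiShift {q : ℕ} (y : Fin q → Fin q → ZMod 2) (a : Fin q × (Fin q → ZMod 2)) :
    Fin q × (Fin q → ZMod 2) :=
  (a.1, a.2 + y a.1)

/-- A transport of the untwisted graph to the graph twisted by `y₀`, except at the base vertex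
`z`. -/
structure CFITransport {q : ℕ} (y₀ : Fin q → Fin q → ZMod 2) (z : Fin q)
    (y : Fin q → Fin q → ZMod 2) : Prop where
  diag : ∀ u, y u u = 0
  twist : ∀ u v, u ≠ v → y u v + y v u = y₀ u v + y₀ v u
  row : ∀ u, u ≠ z → ∑ v, y u v = 0

/-- Adding the edge between `z` and `z'` symmetrically leaves all twists unchanged and flips the row
parities at just these two vertices. -/
theorem CFITransport.move {q : ℕ} {y₀ y : Fin q → Fin q → ZMod 2} {z z' : Fin q}
    (h : CFITransport y₀ z y) (hrow : ∑ v, y z v = 1) (hz : z ≠ z') :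
    CFITransport y₀ z' (fun u v => y u v + (twistAt z z' u v + twistAt z' z u v)) := by
  refine ⟨fun u => ?_, fun u v huv => ?_, fun u hu => ?_⟩
  · have h1 : ¬ (u = z ∧ u = z') := fun h => hz (h.1.symm.trans h.2)
    have h2 : ¬ (u = z' ∧ u = z) := fun h => hz (h.2.symm.trans h.1)
    simp [h.diag, twistAt, h1, h2]
  · rw [← h.twist u v huv]
    have h1 : twistAt z z' v u = twistAt z' z u v := by simp [twistAt, and_comm]
    have h2 : twistAt z' z v u = twistAt z z' u v := by simp [twistAt, and_comm]
    rw [h1, h2]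
    have h3 : ∀ a b t t' : ZMod 2, a + (t + t') + (b + (t' + t)) = a + b := by decide
    exact h3 _ _ _ _
  · rw [Finset.sum_add_distrib, Finset.sum_add_distrib, sum_twistAt, sum_twistAt, if_neg hu,
      add_zero]
    by_cases huz : u = z
    · subst huz
      rw [hrow]
      simp
      decide
    · rw [h.row u huz]
      simp [huz]

/-- The total parity of `y` equals that of the twist, which is 1, and the row at `z` is the only one
that can carry it. -/
theorem CFITransport.row_self {q : ℕ} {u₀ u₁ z : Fin q} (hu : u₀ ≠ u₁)
    {y : Fin q → Fin q → ZMod 2} (h : CFITransport (twistAt u₀ u₁) z y) : ∑ v, y z v = 1 := by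
  have hc := sum_symmetric_eq_zero (fun u v => y u v + twistAt u₀ u₁ u v)
    (fun u => by
      have : ¬ (u = u₀ ∧ u = u₁) := fun h => hu (h.1.symm.trans h.2)
      simp [h.diag, twistAt, this])
    (fun u v => by
      by_cases huv : u = v
      · rw [huv]
      have h2 : ∀ a b t t' : ZMod 2, a + b = t + t' → a + t = b + t' := by decide
      exact h2 _ _ _ _ (h.twist u v huv))
  simp only [Finset.sum_add_distrib, sum_twistAt] at hc
  rw [Fintype.sum_eq_single z fun u hu => h.row u hu] at hc
  simp only [Finset.sum_ite_eq', Finset.mem_univ, if_true] at hc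
  have h2 : ∀ a : ZMod 2, a + 1 = 0 → a = 1 := by decide
  exact h2 _ hc

theorem CFITransport.twistAt_self {q : ℕ} {u₀ u₁ : Fin q} (hu : u₀ ≠ u₁) :
    CFITransport (twistAt u₀ u₁) u₀ (twistAt u₀ u₁) := by
  refine ⟨fun u => ?_, fun _ _ _ => rfl, fun u hu => by rw [sum_twistAt, if_neg hu]⟩
  have : ¬ (u = u₀ ∧ u = u₁) := fun h => hu (h.1.symm.trans h.2)
  simp [twistAt, this]

theorem exists_cfiTransport {q : ℕ} {u₀ u₁ : Fin q} (hu : u₀ ≠ u₁) (z : Fin q) :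
    ∃ y, CFITransport (twistAt u₀ u₁) z y := by
  by_cases hz : u₀ = z
  · subst hz
    exact ⟨_, CFITransport.twistAt_self hu⟩
  · have h := CFITransport.twistAt_self hu
    exact ⟨_, h.move (h.row_self hu) hz⟩

/-- A family of admissible rows shifts the vertices over each base vertex. -/
def cfiPerm {q : ℕ} (y : Fin q → Fin q → ZMod 2) (hd : ∀ u, y u u = 0)
    (hr : ∀ u, ∑ v, y u v = 0) : Equiv.Perm (CFIVertex q) :=
  Function.Involutive.toPerm
    (fun a => ⟨cfiShift y a.1, by
      have := a.2
      simp [cfiShift, hd, hr, this.1, Finset.sum_add_distrib, this.2]⟩)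
    (fun a => by
      refine Subtype.ext (Prod.ext rfl ?_)
      simp only [cfiShift]
      rw [add_assoc, ← two_smul ℕ (y a.1.1)]
      have : (2 : ℕ) • y a.1.1 = 0 := by
        funext v
        simp only [Pi.smul_apply, Pi.zero_apply, two_smul]
        exact CharTwo.add_self_eq_zero _
      rw [this, add_zero])

theorem atomicType_cfi {q r : ℕ} {y₀ y : Fin q → Fin q → ZMod 2}
    (hy : ∀ u v, u ≠ v → y u v + y v u = y₀ u v + y₀ v u) (v w : Fin r → CFIVertex q)
    (h : ∀ i, (w i).1 = cfiShift y (v i).1) :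
    atomicType (cfiGraph (0 : Fin q → Fin q → ZMod 2)) v = atomicType (cfiGraph y₀) w := by
  funext i j
  refine Prod.ext (propext ?_) (propext ?_)
  · simp only [atomicType]
    rw [Subtype.ext_iff, Subtype.ext_iff, h i, h j, Prod.ext_iff, Prod.ext_iff]
    simp only [cfiShift]
    constructor
    · rintro ⟨h1, h2⟩
      exact ⟨h1, by rw [h1, h2]⟩
    · rintro ⟨h1, h2⟩
      refine ⟨h1, ?_⟩
      rw [h1] at h2
      exact add_right_cancel h2
  · simp only [atomicType, cfiGraph, h i, h j, cfiShift, Pi.add_apply, Pi.zero_apply, add_zero]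
    refine and_congr_right fun hne => ?_
    rw [← hy _ _ hne]
    have h2 : ∀ a b t t' : ZMod 2, a + b = 0 ↔ a + t + (b + t') = t + t' := by decide
    exact h2 _ _ _ _

theorem exists_base_notMem {q r : ℕ} (hq : r + 2 ≤ q) (v : Fin r → Fin q) (z : Fin q) :
    ∃ z', z ≠ z' ∧ ∀ i, v i ≠ z' := by
  classical
  -- At most r + 1 base vertices are excluded, and there are at least r + 2.
  have hcard : (insert z (Finset.univ.image v)).card < Fintype.card (Fin q) := by
    refine lt_of_le_of_lt (Finset.card_insert_le _ _) ?_
    have := Finset.card_image_le (s := (Finset.univ : Finset (Fin r))) (f := v)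
    simp at this ⊢
    omega
  obtain ⟨z', hz'⟩ := Finset.exists_mem_notMem_of_card_lt_card
    (s := insert z (Finset.univ.image v)) (t := Finset.univ) (by simpa using hcard)
  simp only [Finset.mem_univ, Finset.mem_insert, Finset.mem_image, true_and, not_or,
    not_exists] at hz'
  exact ⟨z', fun h => hz'.1 h.symm, hz'.2⟩

/-- Tuples related by a transport that fails only at a base vertex off the tuples. -/
def CFIRel {q r : ℕ} (y₀ : Fin q → Fin q → ZMod 2) (v w : Fin r → CFIVertex q) : Prop :=
  ∃ z y, CFITransport y₀ z y ∧ (∀ i, (v i).1.1 ≠ z) ∧ ∀ i, (w i).1 = cfiShift y (v i).1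

/-- The defect sits at `z`, off the tuple. A new vertex `x` over another base vertex is moved by the
same transport; for `x` over `z`, the defect is first moved to a further free base vertex `z'`,
which changes nothing on the tuple. -/
theorem CFIRel.step {q r : ℕ} (hq : r + 2 ≤ q) {u₀ u₁ : Fin q} (hu : u₀ ≠ u₁)
    {v w : Fin r → CFIVertex q} (h : CFIRel (twistAt u₀ u₁) v w) :
    ∃ π : Equiv.Perm (CFIVertex q), ∀ x,
      atomicType (cfiGraph (0 : Fin q → Fin q → ZMod 2))
          (Fin.snoc v x : Fin (r + 1) → CFIVertex q) =
        atomicType (cfiGraph (twistAt u₀ u₁)) (Fin.snoc w (π x) : Fin (r + 1) → CFIVertex q) ∧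
      ∀ i, CFIRel (twistAt u₀ u₁) (Function.update v i x) (Function.update w i (π x)) := by
  obtain ⟨z, y, hy, hvz, hw⟩ := h
  obtain ⟨z', hzz', hvz'⟩ := exists_base_notMem hq (fun i => (v i).1.1) z
  have hy' := hy.move (hy.row_self hu) hzz'
  set y' : Fin q → Fin q → ZMod 2 := fun u v => y u v + (twistAt z z' u v + twistAt z' z u v)
    with hy'def
  have hyy' : ∀ u, u ≠ z → u ≠ z' → y' u = y u := by
    intro u h1 h2
    funext v
    simp [hy'def, twistAt, h1, h2]
  have hw' : ∀ i, (w i).1 = cfiShift y' (v i).1 := by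
    intro i
    rw [hw i, cfiShift, cfiShift, hyy' _ (hvz i) (hvz' i)]
  -- All rows of `Y` are even, so it yields a permutation of the vertices. It need not be a
  -- transport itself; for each single `x` it agrees with one that is valid on the tuple and on `x`.
  let Y : Fin q → Fin q → ZMod 2 := fun u => if u = z then y' u else y u
  let π := cfiPerm Y (fun u => by by_cases h : u = z <;> simp only [Y, h, if_true, if_false,
      hy.diag, hy'.diag])
    (fun u => by
      by_cases h : u = z
      · simp only [Y, h, if_true]
        exact hy'.row z hzz'
      · simp only [Y, h, if_false]
        exact hy.row u h)
  have hπ : ∀ x, (π x).1 = cfiShift Y x.1 := fun x => rfl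
  refine ⟨π, fun x => ?_⟩
  obtain ⟨z'', y'', hy'', hv'', hw'', hx, hπx⟩ : ∃ z'' y'', CFITransport (twistAt u₀ u₁) z'' y'' ∧
      (∀ i, (v i).1.1 ≠ z'') ∧ (∀ i, (w i).1 = cfiShift y'' (v i).1) ∧ x.1.1 ≠ z'' ∧
      (π x).1 = cfiShift y'' x.1 := by
    by_cases hx : x.1.1 = z
    · refine ⟨z', y', hy', hvz', hw', hx ▸ hzz', ?_⟩
      rw [hπ, cfiShift, cfiShift]
      simp only [Y, hx, if_true]
    · refine ⟨z, y, hy, hvz, hw, hx, ?_⟩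
      rw [hπ, cfiShift, cfiShift]
      simp only [Y, hx, if_false]
  refine ⟨atomicType_cfi hy''.twist _ _ fun i => ?_, fun i => ⟨z'', y'', hy'', fun j => ?_,
    fun j => ?_⟩⟩
  · refine Fin.lastCases ?_ (fun i => ?_) i
    · simpa using hπx
    · simpa using hw'' i
  · by_cases hj : j = i
    · subst hj; simpa using hx
    · simpa [Function.update_of_ne hj] using hv'' j
  · by_cases hj : j = i
    · subst hj; simpa using hπx
    · simpa [Function.update_of_ne hj] using hw'' j

theorem exists_perm_cfiRel {q r : ℕ} (hq : r + 2 ≤ q) {u₀ u₁ : Fin q} (hu : u₀ ≠ u₁) :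
    ∃ P : Equiv.Perm (Fin r → CFIVertex q), ∀ v, CFIRel (twistAt u₀ u₁) v (P v) := by
  choose z _ hz using fun b : Fin r → Fin q => exists_base_notMem hq b u₀
  choose y hy using fun z => exists_cfiTransport hu z
  have hrow : ∀ (b : Fin r → Fin q) i, ∑ v, y (z b) (b i) v = 0 := fun b i =>
    (hy (z b)).row _ (hz b i)
  -- The transport depends only on the base vertices of the tuple, which the shift preserves.
  -- Applying it twice therefore gives the identity modulo 2.
  let Φ : (Fin r → CFIVertex q) → Fin r → CFIVertex q := fun v i =>
    ⟨cfiShift (y (z fun j => (v j).1.1)) (v i).1, by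
      have h1 := (v i).2
      have h2 := hrow (fun j => (v j).1.1) i
      simp [cfiShift, (hy _).diag, h1.1, Finset.sum_add_distrib, h1.2, h2]⟩
  have hΦ : Function.Involutive Φ := by
    intro v
    funext i
    refine Subtype.ext (Prod.ext rfl ?_)
    change (v i).1.2 + y (z fun j => (v j).1.1) (v i).1.1 +
      y (z fun j => (v j).1.1) (v i).1.1 = (v i).1.2
    funext c
    simp only [Pi.add_apply]
    have h2 : ∀ a b : ZMod 2, a + b + b = a := by decide
    exact h2 _ _
  exact ⟨hΦ.toPerm, fun v => ⟨_, _, hy (z fun j => (v j).1.1), hz _, fun i => rfl⟩⟩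

/-- For every `r` there are non-isomorphic graphs that the `r`-dimensional Weisfeiler-Lehman test
does not distinguish. -/
theorem exists_not_wlDistinguishes (r : ℕ) :
    ∃ (n : ℕ) (G₁ G₂ : SimpleGraph (Fin n)), ¬ Nonempty (G₁ ≃g G₂) ∧
      ¬ WLDistinguishes r G₁ G₂ := by
  let q := r + 2
  let u₀ : Fin q := ⟨0, by omega⟩
  let u₁ : Fin q := ⟨1, by omega⟩
  have hu : u₀ ≠ u₁ := by simp [u₀, u₁]
  let ι := Fintype.equivFin (CFIVertex q)
  let G : SimpleGraph (CFIVertex q) := cfiGraph 0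
  let H : SimpleGraph (CFIVertex q) := cfiGraph (twistAt u₀ u₁)
  let eG : G ≃g G.map ι.toEmbedding := SimpleGraph.Iso.map ι G
  let eH : H ≃g H.map ι.toEmbedding := SimpleGraph.Iso.map ι H
  refine ⟨_, G.map ι.toEmbedding, H.map ι.toEmbedding, ?_, ?_⟩
  · rintro ⟨e⟩
    exact not_nonempty_cfiGraph_iso hu ⟨(eG.trans e).trans eH.symm⟩
  · rintro ⟨s, hs⟩
    apply hs
    obtain ⟨P, hP⟩ := exists_perm_cfiRel (le_refl (r + 2)) hu
    let A := Equiv.arrowCongr (Equiv.refl (Fin r)) ι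
    refine univ_val_map_perm ((A.symm.trans P).trans A) fun v => ?_
    have h1 := wlColor_iso eG r s (A.symm v)
    have h2 := wlColor_iso eH r s (P (A.symm v))
    have h3 : eG ∘ A.symm v = v := by
      funext i
      exact ι.apply_symm_apply (v i)
    rw [h3] at h1
    rw [h1]
    refine Eq.trans ?_ h2.symm
    exact wlColor_eq_of_backAndForth (CFIRel (twistAt u₀ u₁))
      (fun v w ⟨z, y, hy, _, hw⟩ => atomicType_cfi hy.twist v w hw)
      (fun v w h => h.step (le_refl (r + 2)) hu) s _ _ (hP _)

/-! ### Assembly of the theorem -/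

theorem nonempty_lapReps_zero (N m : ℕ) : (lapReps N m (⊥ : SimpleGraph (Fin 0))).Nonempty := by
  refine ⟨0, Fin.elim0, default, fun i => i.elim0, fun i => i.elim0, fun j i => ?_⟩
  simp

theorem mainTheorem2 :
    -- the node-LPE Transformer
    (∀ (N k m : ℕ) (M : LPEInput N m →ₗ[ℝ] LPEHidden N k m) (R : ℝ),
      1 ≤ N → N ≤ m → Function.Injective M →
      (∀ (n : ℕ) (G : SimpleGraph (Fin n)), n ≤ N →
        ∀ T ∈ lapReps N m G, M T ∈ Metric.closedBall (0 : LPEHidden N k m) R) →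
      (∃ f : LPEHidden N k m → LPEHidden N k m,
        ContinuousOn f (Metric.closedBall 0 R) ∧
        (∃ c₀ : Fin k, ∀ X j c i, c ≠ c₀ → f X ((j, c), i) = 0) ∧
        SeparatesIsoClasses N (fun _ G => lapReps N m G) (fun T => f (M T)) ∧
        SeparatesIsoClasses N (fun _ G => lapReps N m G) (fun T => sumPool (f (M T)))) ∧
      (∀ f : LPEHidden N k m → LPEHidden N k m,
        ContinuousOn f (Metric.closedBall 0 R) →
        ∀ (p : ℝ≥0∞) (ε : ℝ), 1 ≤ p → p ≠ ∞ → 0 < ε →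
        ∀ P : Finset (LPEInput N m),
          (∀ T ∈ P, ∃ (n : ℕ) (G : SimpleGraph (Fin n)), n ≤ N ∧ T ∈ lapReps N m G) →
        ∃ (t : Transformer (Fin N × Fin k)) (E : LPEHidden N k m),
          MeasureTheory.eLpNorm (fun X => f X - t.applyPE E X) p
            (MeasureTheory.volume.restrict (Metric.closedBall 0 R)) < ENNReal.ofReal ε ∧
          MeasureTheory.eLpNorm (fun T => sumPool (f (M T)) - lpeTransformer M t E T) p
            (MeasureTheory.volume.restrict {T | M T ∈ Metric.closedBall 0 R})
              < ENNReal.ofReal ε ∧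
          ∀ T ∈ P, dist (sumPool (f (M T))) (lpeTransformer M t E T) < ε)) ∧
    -- the naive node Transformer
    (∀ (N : ℕ) (R : ℝ),
      (∀ (n : ℕ) (G : SimpleGraph (Fin n)), n ≤ N →
        nodeInput N G ∈ Metric.closedBall (0 : SeqSpace (Fin N) (Fin N)) R) →
      (∃ f : SeqSpace (Fin N) (Fin N) → SeqSpace (Fin N) (Fin N),
        ContinuousOn f (Metric.closedBall 0 R) ∧
        SeparatesIsoClasses N (fun _ G => {nodeInput N G}) f) ∧
      (∀ f : SeqSpace (Fin N) (Fin N) → SeqSpace (Fin N) (Fin N),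
        ContinuousOn f (Metric.closedBall 0 R) →
        ∀ (p : ℝ≥0∞) (ε : ℝ), 1 ≤ p → p ≠ ∞ → 0 < ε →
        ∃ (t : Transformer (Fin N)) (E : SeqSpace (Fin N) (Fin N)),
          MeasureTheory.eLpNorm (fun X => f X - t.applyPE E X) p
            (MeasureTheory.volume.restrict (Metric.closedBall 0 R)) < ENNReal.ofReal ε ∧
          ∀ (n : ℕ) (G : SimpleGraph (Fin n)), n ≤ N →
            dist (f (nodeInput N G)) (t.applyPE E (nodeInput N G)) < ε)) ∧
    -- the naive edge Transformer
    (∀ (N : ℕ) (code : NodePair N → ℝ) (R : ℝ), Function.Injective code →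
      (∀ G : SimpleGraph (Fin N),
        edgeInput code G ∈ Metric.closedBall (0 : SeqSpace (Fin 2) (NodePair N)) R) →
      (∃ f : SeqSpace (Fin 2) (NodePair N) → SeqSpace (Fin 2) (NodePair N),
        ContinuousOn f (Metric.closedBall 0 R) ∧
        (∀ (σ : Equiv.Perm (NodePair N)) (X), X ∈ Metric.closedBall 0 R →
          f (permCols σ X) = permCols σ (f X)) ∧
        ∀ G₁ G₂ : SimpleGraph (Fin N),
          f (edgeInput code G₁) = f (edgeInput code G₂) ↔ Nonempty (G₁ ≃g G₂)) ∧
      (∀ f : SeqSpace (Fin 2) (NodePair N) → SeqSpace (Fin 2) (NodePair N),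
        ContinuousOn f (Metric.closedBall 0 R) →
        (∀ (σ : Equiv.Perm (NodePair N)) (X), X ∈ Metric.closedBall 0 R →
          f (permCols σ X) = permCols σ (f X)) →
        ∀ (p : ℝ≥0∞) (ε : ℝ), 1 ≤ p → p ≠ ∞ → 0 < ε →
        ∃ t : Transformer (Fin 2),
          MeasureTheory.eLpNorm (fun X => f X - t.apply X) p
            (MeasureTheory.volume.restrict (Metric.closedBall 0 R)) < ENNReal.ofReal ε ∧
          ∀ G : SimpleGraph (Fin N),
            dist (f (edgeInput code G)) (t.apply (edgeInput code G)) < ε)) ∧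
    -- with enough parameters, one node-LPE Transformer tells apart all non-isomorphic graphs
    (∀ (N m : ℕ) (ε : ℝ), 1 ≤ N → N ≤ m → 0 < ε →
      ∃ (k : ℕ) (W : Matrix (Fin k) (Fin 2) ℝ) (t : Transformer (Fin N × Fin k))
        (E : LPEHidden N k m), Function.Injective W.mulVec ∧
        ApproxSolvesIso ε (lpeTransformer (lpeLinear N m W) t E)) ∧
    -- it is strictly more powerful than the Weisfeiler-Lehman test of any dimension
    (∀ r : ℕ, 1 ≤ r → ∃ N₀ : ℕ, ∀ (N m : ℕ) (ε : ℝ), 1 ≤ N → N₀ ≤ N → N ≤ m → 0 < ε →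
      ∃ (k : ℕ) (W : Matrix (Fin k) (Fin 2) ℝ) (t : Transformer (Fin N × Fin k))
        (E : LPEHidden N k m), Function.Injective W.mulVec ∧
        ApproxSolvesIso ε (lpeTransformer (lpeLinear N m W) t E) ∧
        (∀ (n₁ n₂ : ℕ) (G₁ : SimpleGraph (Fin n₁)) (G₂ : SimpleGraph (Fin n₂)),
          n₁ ≤ N → n₂ ≤ N → WLDistinguishes r G₁ G₂ →
            Distinguishes (lpeTransformer (lpeLinear N m W) t E) G₁ G₂) ∧
        ∃ (n : ℕ) (G₁ G₂ : SimpleGraph (Fin n)), n ≤ N ∧ ¬ Nonempty (G₁ ≃g G₂) ∧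
          ¬ WLDistinguishes r G₁ G₂ ∧
          Distinguishes (lpeTransformer (lpeLinear N m W) t E) G₁ G₂) := by
  refine ⟨fun N k m M R hN hm hM hR => ⟨?_, fun f hf p ε hp hp' hε P hP => ?_⟩,
    fun N R hR => ⟨?_, fun f hf p ε hp hp' hε => exists_node_approx hR f hf hp hp' hε⟩,
    fun N code R hcode hR => ⟨?_, fun f hf hσ p ε hp hp' hε =>
      exists_edge_approx hcode hR f hf hσ hp hp' hε⟩,
    fun N m ε hN hm hε => exists_approxSolvesIso hN hm hε, fun r _ => ?_⟩
  · obtain ⟨f, hf, h⟩ := exists_lpe_separating M hN hm hM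
    exact ⟨f, hf.continuousOn, h⟩
  · refine exists_lpe_approx M ?_ (nonempty_hidden_index M hN hm hM) hM f hf hp hp' hε P
      fun T hT => ?_
    -- The empty graph has a representation, so the ball contains a point and `R` is nonnegative.
    · obtain ⟨T, hT⟩ := nonempty_lapReps_zero N m
      exact (norm_nonneg _).trans (mem_closedBall_zero_iff.1 (hR 0 ⊥ (Nat.zero_le _) T hT))
    · obtain ⟨n, G, hn, hTG⟩ := hP T hT
      exact hR n G hn T hTG
  · obtain ⟨f, hf, h⟩ := exists_node_separating N
    exact ⟨f, hf.continuousOn, h⟩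
  · obtain ⟨f, hf, h1, h2⟩ := exists_edge_separating hcode
    exact ⟨f, hf.continuousOn, fun σ X _ => h1 σ X, h2⟩
  · obtain ⟨n, G₁, G₂, hG, hWL⟩ := exists_not_wlDistinguishes r
    -- The threshold N₀ is the size of the Cai-Fürer-Immerman pair.
    refine ⟨n, fun N m ε hN hnN hm hε => ?_⟩
    obtain ⟨k, W, t, E, hW, h⟩ := exists_approxSolvesIso hN hm hε
    exact ⟨k, W, t, E, hW, h, fun n₁ n₂ H₁ H₂ h₁ h₂ hd => (h n₁ n₂ H₁ H₂ h₁ h₂).2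
      fun ⟨e⟩ => not_wlDistinguishes_of_iso e r hd,
      n, G₁, G₂, hnN, hG, hWL, (h n n G₁ G₂ hnN hnN).2 hG⟩
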